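/- **Setting.** Let $N,K,L,T,\tau\ge 1$ be integers and put $n=NT\tau$. The vectorised cascaded channel $c\in\mathbb C^{NKL}$ is circularly symmetric complex Gaussian, $c\sim\mathcal{CN}(0,\Sigma_c)$ ($\Sigma_c$ possibly singular), and the observation is $$y=\bar S c+w\in\mathbb C^{n},\qquad \bar S=S^{\mathrm T}\otimes X^{\mathrm T}\otimes I_N,\qquad w\sim\mathcal{CN}(0,\sigma^2 I_n),\ \sigma>0,$$ where $S\in\mathbb C^{L\times T}$ and $X\in\mathbb C^{K\times\tau}$ are deterministic and $w$ is independent of $c$. Put $\Sigma_y=\mathbb E[yy^{\mathrm H}]$, $\Gamma_c=\mathbb E[cy^{\mathrm H}]\Sigma_y^{-1}$ and $\tilde c=\mathbb E[c\mid y]$, and assume $\Gamma_c\ne 0$. Let $1\le G_c\le n$, let $\nu\ge1$, let $\tilde\nu=\lfloor\nu^{1/(2G_c)}\rfloor$ be the resolution of the identical scalar ADCs, let $\eta_c>0$ satisfy $2\eta_c^2<3\tilde\nu^2$, and put $\kappa_c=\eta_c^2\bigl(1-\tfrac{2\eta_c^2}{3\tilde\nu^2}\bigr)^{-1}$. A hardware-limited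 task-based quantizer consists of an analog combiner $B\in\mathbb C^{G_c\times n}$, an ADC support $\gamma\ge0$ and a digital matrix $D\in\mathbb C^{NKL\times G_c}$. With the step $\Delta=2\gamma/\tilde\nu$, the support of $B$ is fixed by the rule $$\gamma^2=\eta_c^2\max_{g}\mathbb E\bigl|[By]_g+\beta_g\bigr|^2,$$ where the dither $\beta_g$ is independent of $y$ and has independent real and imaginary parts, each uniform on $[-\Delta/2,\Delta/2]$. The ADC outputs are modelled as $By+e$, where the quantization noise $e$ has zero mean, is uncorrelated with $y$, has mutually uncorrelated entries, and has variance $\Delta^2/6$ in the real and in the imaginary part of each entry; the estimate is $\hat c=D(By+e)$. Define $$\mathrm{MSE}(B,\gamma)=\operatorname{tr}\bigl(\Gamma_c\Sigma_y\Gamma_c^{\mathrm H}\bigr)-\operatorname{tr}\Bigl(\Gamma_c\Sigma_yB^{\mathrm H}\bigl(B\Sigma_yB^{\mathrm H}+\tfrac{4\gamma^2}{3\tilde\nu^2}I\bigr)^{-1}B\Sigma_y\Gamma_c^{\mathrm H}\Bigr)$$ (for $B=0$, $\gamma=0$ the second trace is read as $0$). **Proposition.** For every $B$, every $\gamma$ that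 satisfies the support rule for $B$ and every such noise $e$, $\min_D\mathbb E\|\tilde c-\hat c\|_2^2=\mathrm{MSE}(B,\gamma)$. Let $\lambda_1\ge\lambda_2\ge\dots\ge\lambda_n\ge0$ be the singular values of $\widetilde\Gamma_c=\Gamma_c\Sigma_y^{1/2}$ (padded with zeros if necessary). There exist $V_c,\zeta_c,\Lambda_c,U_c$ such that 1. $V_c\in\mathbb C^{n\times n}$ is a unitary matrix whose columns are right singular vectors of $\widetilde\Gamma_c$, in the order of the $\lambda_g$; 2. $\Lambda_c\in\mathbb C^{G_c\times n}$ is (rectangular) diagonal with $$([\Lambda_c]_{g,g})^2=\frac{4\kappa_c}{3\tilde\nu^2G_c}(\zeta_c\lambda_g-1)^+,\qquad \frac{4\kappa_c}{3\tilde\nu^2G_c}\sum_{g=1}^{G_c}(\zeta_c\lambda_g-1)^+=1;$$ 3. $U_c\in\mathbb C^{G_c\times G_c}$ is unitary and all diagonal entries of $U_c\Lambda_c\Lambda_c^{\mathrm H}U_c^{\mathrm H}$ are equal. For every such choice, the combiner $B_c^{\mathrm o}=U_c\Lambda_cV_c^{\mathrm H}\Sigma_y^{-1/2}$ is MSE-optimal: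 - its ADC support is $\gamma_c=\sqrt{\kappa_c/G_c}$, the only $\gamma\ge0$ that satisfies the support rule for $B_c^{\mathrm o}$; - $\mathrm{MSE}(B_c^{\mathrm o},\gamma_c)\le\mathrm{MSE}(B,\gamma)$ for every $B\in\mathbb C^{G_c\times n}$ and every $\gamma$ that satisfies the support rule for $B$. -/

import Mathlib

open MeasureTheory ProbabilityTheory Matrix
open scoped Matrix MatrixOrder Kronecker

noncomputable section

namespace TaskQuant

/-- Index set of the stacked observation `y`: sub-block, time slot in the sub-block, antenna. -/
abbrev ObsIdx (N T τ : ℕ) : Type := Fin T × Fin τ × Fin N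

/-- Index set of the vectorised cascaded channel `c = vec (Fᵀ ⋄ G)`: surface element, user,
antenna. -/
abbrev ChanIdx (N K L : ℕ) : Type := Fin L × Fin K × Fin N

/-- The matrix `Sᵀ ⊗ Xᵀ ⊗ I_N` through which the cascaded channel is observed; `S` holds the
reflection vectors and `X` the pilots. -/
def sensingMatrix {N K L T τ : ℕ} (S : Matrix (Fin L) (Fin T) ℂ) (X : Matrix (Fin K) (Fin τ) ℂ) :
    Matrix (ObsIdx N T τ) (ChanIdx N K L) ℂ :=
  Sᵀ ⊗ₖ (Xᵀ ⊗ₖ (1 : Matrix (Fin N) (Fin N) ℂ))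

/-- The received signal `y = (Sᵀ ⊗ Xᵀ ⊗ I_N) c + n`. -/
def received {N K L T τ : ℕ} {Ω : Type*} (S : Matrix (Fin L) (Fin T) ℂ)
    (X : Matrix (Fin K) (Fin τ) ℂ) (c : Ω → ChanIdx N K L → ℂ) (n : Ω → ObsIdx N T τ → ℂ) :
    Ω → ObsIdx N T τ → ℂ :=
  fun ω => sensingMatrix S X *ᵥ c ω + n ω

section Probability

variable {Ω : Type*} [MeasurableSpace Ω]

/-- `E[u vᴴ]`. -/
def crossMoment (μ : Measure Ω) {ι κ : Type*} (u : Ω → ι → ℂ) (v : Ω → κ → ℂ) : Matrix ι κ ℂ :=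
  Matrix.of fun i j => ∫ ω, u ω i * star (v ω j) ∂μ

/-- `x ∼ 𝒞𝒩(0, Q)`: the (possibly degenerate) circularly symmetric complex Gaussian law. -/
structure IsCircularGaussian (μ : Measure Ω) {ι : Type*} [Fintype ι] (x : Ω → ι → ℂ)
    (Q : Matrix ι ι ℂ) : Prop where
  gaussian : HasGaussianLaw x μ
  mean_zero : ∀ i, ∫ ω, x ω i ∂μ = 0
  covariance : crossMoment μ x x = Q
  circular : ∀ i j, ∫ ω, x ω i * x ω j ∂μ = 0

/-- The MMSE estimate `E[c | y]`. -/
def mmse (μ : Measure Ω) {ι κ : Type*} [Fintype ι] (c : Ω → ι → ℂ) (y : Ω → κ → ℂ) :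
    Ω → ι → ℂ :=
  μ[c | MeasurableSpace.comap y inferInstance]

/-- `Γ = E[c yᴴ] (E[y yᴴ])⁻¹`. -/
def linearEstimator (μ : Measure Ω) {ι κ : Type*} [Fintype κ] [DecidableEq κ]
    (c : Ω → ι → ℂ) (y : Ω → κ → ℂ) : Matrix ι κ ℂ :=
  crossMoment μ c y * (crossMoment μ y y)⁻¹

end Probability

/-- Resolution of each of the `2G` identical scalar ADCs: `ν̃ = ⌊ν^(1/(2G))⌋`. -/
def adcLevels (ν : ℝ) (G : ℕ) : ℕ := ⌊ν ^ (1 / (2 * (G : ℝ)))⌋₊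

/-- Quantization step `Δ = 2γ/ν̃` of an ADC with support `γ`. -/
def stepSize (lv : ℕ) (γ : ℝ) : ℝ := 2 * γ / lv

/-- Law of a complex dither signal: independent real and imaginary parts, each uniform on
`[-Δ/2, Δ/2]` (the Dirac mass at `0` if `Δ = 0`). -/
def ditherLaw (Δ : ℝ) : Measure ℂ :=
  Measure.map (fun p : ℝ × ℝ => (⟨Δ * p.1, Δ * p.2⟩ : ℂ))
    ((volume.restrict (Set.Icc (-1 / 2 : ℝ) (1 / 2))).prod
      (volume.restrict (Set.Icc (-1 / 2 : ℝ) (1 / 2))))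

section ADC

variable {Ω : Type*} [MeasurableSpace Ω] {κ : Type*} [Fintype κ]

/-- `E |[B y]_g + β_g|²`, the dither `β_g` being independent of `y`. -/
def adcInputPower (μ : Measure Ω) (y : Ω → κ → ℂ) (lv : ℕ) {G : ℕ} (B : Matrix (Fin G) κ ℂ)
    (γ : ℝ) (g : Fin G) : ℝ :=
  ∫ p : Ω × ℂ, ‖(B *ᵥ y p.1) g + p.2‖ ^ 2 ∂(μ.prod (ditherLaw (stepSize lv γ)))

/-- Design rule for the ADC support of a combiner `B`: `γ` is `η` times the largest standard
deviation of the dithered ADC inputs (the law of the dither depends on `γ` itself). -/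
def IsAdcSupport (μ : Measure Ω) (y : Ω → κ → ℂ) (lv : ℕ) (η : ℝ) {G : ℕ}
    (B : Matrix (Fin G) κ ℂ) (γ : ℝ) : Prop :=
  0 ≤ γ ∧ γ ^ 2 = η ^ 2 * ⨆ g : Fin G, adcInputPower μ y lv B γ g

/-- Model of the quantization noise of `G` dithered ADC pairs of support `γ` whose inputs are
linear in `y`: zero mean, uncorrelated with `y`, white, and with variance `Δ²/6` in each of the
real and imaginary parts. -/
structure IsQuantNoise (μ : Measure Ω) (y : Ω → κ → ℂ) (lv : ℕ) (γ : ℝ) {G : ℕ}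
    (e : Ω → Fin G → ℂ) : Prop where
  memLp : ∀ g, MemLp (fun ω => e ω g) 2 μ
  mean_zero : ∀ g, ∫ ω, e ω g ∂μ = 0
  uncorrelated : crossMoment μ y e = 0
  variance_re : ∀ g, ∫ ω, (e ω g).re ^ 2 ∂μ = stepSize lv γ ^ 2 / 6
  variance_im : ∀ g, ∫ ω, (e ω g).im ^ 2 ∂μ = stepSize lv γ ^ 2 / 6
  white : ∀ g h, g ≠ h → ∫ ω, e ω g * star (e ω h) ∂μ = 0

/-- `E ‖c̃ - ĉ‖²` for the digital estimate `ĉ = D π` from the ADC outputs `π = B y + e`. -/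
def distortion (μ : Measure Ω) {ι : Type*} [Fintype ι] (ct : Ω → ι → ℂ) (y : Ω → κ → ℂ) {G : ℕ}
    (B : Matrix (Fin G) κ ℂ) (e : Ω → Fin G → ℂ) (D : Matrix ι (Fin G) ℂ) : ℝ :=
  ∫ ω, ∑ i, ‖ct ω i - (D *ᵥ (B *ᵥ y ω + e ω)) i‖ ^ 2 ∂μ

end ADC

/-- The MSE distortion left by the best digital processing matrix,
`tr(Γ Σ Γᴴ) - tr(Γ Σ Bᴴ (B Σ Bᴴ + (4γ²/(3ν̃²)) I)⁻¹ B Σ Γᴴ)`. For `B = 0`, `γ = 0` the inverse of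
the zero matrix is `0` and the value is `tr(Γ Σ Γᴴ)`, as it should be. -/
def digitalMSE {ι κ : Type*} [Fintype ι] [Fintype κ] (Γ : Matrix ι κ ℂ) (Sy : Matrix κ κ ℂ)
    (lv : ℕ) {G : ℕ} (B : Matrix (Fin G) κ ℂ) (γ : ℝ) : ℝ :=
  (trace (Γ * Sy * Γᴴ)
    - trace (Γ * Sy * Bᴴ
        * (B * Sy * Bᴴ + ((4 * γ ^ 2 / (3 * (lv : ℝ) ^ 2) : ℝ) : ℂ) • (1 : Matrix _ _ ℂ))⁻¹
        * B * Sy * Γᴴ)).re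

/-- `κ = η² (1 - 2η²/(3ν̃²))⁻¹`. -/
def kappa (η : ℝ) (lv : ℕ) : ℝ := η ^ 2 * (1 - 2 * η ^ 2 / (3 * (lv : ℝ) ^ 2))⁻¹

/-- The `g`-th (from `0`) singular value of `A`, in descending order, padded with zeros. -/
def singVal {ι κ : Type*} [Fintype ι] [Fintype κ] [DecidableEq κ] (A : Matrix ι κ ℂ)
    (g : ℕ) : ℝ :=
  (Matrix.toEuclideanLin A).singularValues g

/-- `V` is a unitary matrix of right singular vectors of `A`: its `j`-th column is a
unit eigenvector of `Aᴴ A` for the square of the `j`-th largest singular value. -/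
structure IsRightSingularMatrix {ι κ : Type*} [Fintype ι] [Fintype κ] [DecidableEq κ] {d : ℕ}
    (A : Matrix ι κ ℂ) (V : Matrix κ (Fin d) ℂ) : Prop where
  unitary_left : Vᴴ * V = 1
  unitary_right : V * Vᴴ = 1
  right_singular : Aᴴ * A * V = V * diagonal fun j : Fin d => ((singVal A j ^ 2 : ℝ) : ℂ)

/-- The conditions on the factors `V`, `ζ`, `Λ`, `U` of the combiner, for the matrix `A = Γ Σ^(1/2)`
and the constant `a = 4κ/(3ν̃²G)`. -/
structure IsWaterFillingDesign {ι κ : Type*} [Fintype ι] [Fintype κ] [DecidableEq κ] {G d : ℕ}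
    (hG : G ≤ d) (A : Matrix ι κ ℂ) (a : ℝ) (V : Matrix κ (Fin d) ℂ) (ζ : ℝ)
    (Λ : Matrix (Fin G) (Fin d) ℂ) (U : Matrix (Fin G) (Fin G) ℂ) : Prop where
  right_singular : IsRightSingularMatrix A V
  water_level : a * ∑ g : Fin G, max (ζ * singVal A g - 1) 0 = 1
  off_diagonal : ∀ (g : Fin G) (j : Fin d), j ≠ Fin.castLE hG g → Λ g j = 0
  diagonal_entry : ∀ g : Fin G,
    Λ g (Fin.castLE hG g) ^ 2 = ((a * max (ζ * singVal A g - 1) 0 : ℝ) : ℂ)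
  unitary : U ∈ Matrix.unitaryGroup (Fin G) ℂ
  equal_diagonal : ∀ g h : Fin G,
    (U * Λ * Λᴴ * Uᴴ) g g = (U * Λ * Λᴴ * Uᴴ) h h

/-- The combiner `U Λ Vᴴ Σ^(-1/2)`. -/
def combiner {κ : Type*} [Fintype κ] [DecidableEq κ] {G d : ℕ} (Sy : Matrix κ κ ℂ)
    (V : Matrix κ (Fin d) ℂ) (Λ : Matrix (Fin G) (Fin d) ℂ) (U : Matrix (Fin G) (Fin G) ℂ) :
    Matrix (Fin G) κ ℂ :=
  U * Λ * Vᴴ * (CFC.sqrt Sy)⁻¹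

end TaskQuant

end

/-!
The proof has a probabilistic and a matrix part.

*Probability.* The error `c - Γ y` and `y` are jointly Gaussian, and both `E[(c - Γ y) yᴴ]` and
`E[(c - Γ y) yᵀ]` vanish (the latter by circularity), so they are independent and `E[c | y] = Γ y`
(`mmse_received_ae_eq`). The distortion is then a quadratic function of the digital matrix `D`, and
completing the square (`trace_complete_square`) identifies its least value with `digitalMSE`. The
dither adds `Δ² / 6`, a multiple of `γ²`, to each input power; solving the support rule for `γ²`
gives `γ² = κ max_g (B Σ Bᴴ)_gg` (`isAdcSupport_iff`).

*Matrices.* Put `A = Γ Σ^(1/2)`, `M = B Σ^(1/2)`, with `λ_j` the singular values of `A`. The quantity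
to maximise is `tr(A Mᴴ (M Mᴴ + s)⁻¹ M Aᴴ)`, where `s = 4γ²/(3ν̃²) = a G max_g (M Mᴴ)_gg` is at least
`a tr(M Mᴴ)`. A unitary change of coordinates on the left and `V` on the right turn `M` into a matrix
`N` with orthogonal rows of squared norms `m_i`, and the trace becomes
`∑ᵢⱼ |N_ij|² λ_j² / (m_i + s)` (`mseReduction_eq_sum`). No trace inequality of von Neumann type is
needed: with the Lagrange multiplier `t² = ζ⁻²`, the scalar inequality
`m / (m + s) λ² ≤ t² m / s + ((λ - t)⁺)²` is applied to each term with the weight `|N_ij|² / m_i`.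
Bessel's inequality bounds the total weight of each column by `1`, and the total weight is at most
`G`; since `((λ_j - t)⁺)²` decreases in `j`, the sum is at most `t² / a + ∑_{g < G} ((λ_g - t)⁺)²`
(`mseReduction_le`). The water-filling design attains this value (`mseReduction_eq`), because its
rotation `U` makes all input powers equal, so that `s = a tr(M Mᴴ)` for it.
-/

namespace TaskQuant

/-! ### Water-filling bound on the MSE reduction -/

/-- Lagrangian bound on the gain of one singular direction with power `m`; for `t > 0`, equality holds at
`m / s = (l / t - 1)⁺`. -/
lemma div_mul_sq_le_waterfilling {l t m s : ℝ} (hl : 0 ≤ l) (hm : 0 ≤ m)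
    (hs : 0 < s) : m / (m + s) * l ^ 2 ≤ t ^ 2 * (m / s) + max (l - t) 0 ^ 2 := by
  have hms : 0 < m + s := by positivity
  rcases le_total l t with h | h
  · rw [max_eq_right (by linarith)]
    have h1 : m / (m + s) ≤ m / s := by gcongr; linarith
    have h2 : l ^ 2 ≤ t ^ 2 := by gcongr
    have h3 : 0 ≤ m / (m + s) := by positivity
    nlinarith [sq_nonneg t]
  · rw [max_eq_left (by linarith)]
    have : t ^ 2 * (m / s) + (l - t) ^ 2 - m / (m + s) * l ^ 2
        = (l * s - t * (m + s)) ^ 2 / (s * (m + s)) := by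
      field_simp
      ring
    have h2 : 0 ≤ (l * s - t * (m + s)) ^ 2 / (s * (m + s)) := by positivity
    linarith

/-- Weights in `[0, 1]` of total at most `G` are best spent on the `G` largest values. -/
lemma sum_mul_le_sum_castLE {G d : ℕ} (hG0 : 0 < G) (hG : G ≤ d) {f w : Fin d → ℝ}
    (hf : Antitone f) (hf0 : ∀ j, 0 ≤ f j) (hw0 : ∀ j, 0 ≤ w j) (hw1 : ∀ j, w j ≤ 1)
    (hw : ∑ j, w j ≤ G) : ∑ j, f j * w j ≤ ∑ g : Fin G, f (Fin.castLE hG g) := by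
  set j₀ : Fin d := Fin.castLE hG ⟨G - 1, by omega⟩
  have h1 : ∑ j, (f j - f j₀) * w j ≤ ∑ g : Fin G, (f (Fin.castLE hG g) - f j₀) := by
    have h2 : ∀ j, (f j - f j₀) * w j ≤ if (j : ℕ) < G then f j - f j₀ else 0 := by
      intro j
      split_ifs with h
      · have : f j₀ ≤ f j := hf (by simp only [j₀, Fin.le_def, Fin.val_castLE]; omega)
        exact mul_le_of_le_one_right (by linarith) (hw1 j)
      · have : f j ≤ f j₀ := hf (by simp only [j₀, Fin.le_def, Fin.val_castLE]; omega)
        exact mul_nonpos_of_nonpos_of_nonneg (by linarith) (hw0 j)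
    refine (Finset.sum_le_sum fun j _ => h2 j).trans (le_of_eq ?_)
    rw [← Finset.sum_filter]
    symm
    refine Finset.sum_bij (fun g _ => Fin.castLE hG g) (by simp)
      (fun a _ b _ h => by simpa using h) (fun j hj => ?_) (fun _ _ => rfl)
    exact ⟨⟨j, (Finset.mem_filter.1 hj).2⟩, by simp, by ext; simp⟩
  have h3 : f j₀ * ∑ j, w j ≤ f j₀ * G := by gcongr; exact hf0 _
  have h4 : ∑ j, (f j - f j₀) * w j = ∑ j, f j * w j - f j₀ * ∑ j, w j := by
    simp [sub_mul, Finset.sum_sub_distrib, Finset.mul_sum]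
  have h5 : ∑ g : Fin G, (f (Fin.castLE hG g) - f j₀)
      = ∑ g : Fin G, f (Fin.castLE hG g) - f j₀ * G := by
    simp [Finset.sum_sub_distrib, mul_comm]
  linarith

lemma conjTranspose_mul_self_apply_self {ι κ : Type*} [Fintype ι] (E : Matrix ι κ ℂ) (j : κ) :
    (Eᴴ * E) j j = ((∑ i, ‖E i j‖ ^ 2 : ℝ) : ℂ) := by
  simp [Matrix.mul_apply, conjTranspose_apply, Complex.conj_mul']

lemma mul_conjTranspose_self_apply_self {ι κ : Type*} [Fintype κ] (E : Matrix ι κ ℂ) (i : ι) :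
    (E * Eᴴ) i i = ((∑ j, ‖E i j‖ ^ 2 : ℝ) : ℂ) := by
  simp [Matrix.mul_apply, conjTranspose_apply, Complex.mul_conj']

/-- Bessel's inequality for a matrix with orthogonal rows: after normalising the nonzero rows, every
column has norm at most `1`. A zero row contributes `‖0‖ ^ 2 / 0 = 0`. -/
lemma sum_norm_sq_div_le_one {ι κ : Type*} [Fintype ι] [DecidableEq ι] [Fintype κ]
    {N : Matrix ι κ ℂ} {m : ι → ℝ} (hm : ∀ i, 0 ≤ m i)
    (hN : N * Nᴴ = diagonal fun i => (m i : ℂ)) (j : κ) : ∑ i, ‖N i j‖ ^ 2 / m i ≤ 1 := by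
  -- `E` has orthonormal or zero rows, so `Eᴴ E` is an orthogonal projection, whose diagonal entries
  -- `p` satisfy `p² ≤ p`.
  set E : Matrix ι κ ℂ := diagonal (fun i => (((√(m i))⁻¹ : ℝ) : ℂ)) * N with hE
  set δ : ι → ℂ := fun i => if m i = 0 then 0 else 1
  have hEE : E * Eᴴ = diagonal δ := by
    rw [hE, conjTranspose_mul, Matrix.mul_assoc, ← Matrix.mul_assoc N, hN,
      diagonal_conjTranspose, diagonal_mul_diagonal, diagonal_mul_diagonal]
    congr 1
    ext i
    simp only [δ, Pi.star_apply, RCLike.star_def, Complex.conj_ofReal]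
    rw [← Complex.ofReal_mul, ← Complex.ofReal_mul]
    split_ifs with h
    · simp [h]
    · have h1 : √(m i) ≠ 0 := (Real.sqrt_pos.2 ((hm i).lt_of_ne' h)).ne'
      norm_cast
      field_simp
      exact (Real.sq_sqrt (hm i)).symm
  have hδE : diagonal δ * E = E := by
    rw [hE, ← Matrix.mul_assoc, diagonal_mul_diagonal]
    congr 2
    ext i
    simp only [δ]
    split_ifs with h <;> simp [h]
  have hP : (Eᴴ * E)ᴴ * (Eᴴ * E) = Eᴴ * E := by
    rw [conjTranspose_mul, conjTranspose_conjTranspose, Matrix.mul_assoc, ← Matrix.mul_assoc E,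
      hEE, hδE]
  have h1 := conjTranspose_mul_self_apply_self (Eᴴ * E) j
  rw [hP, conjTranspose_mul_self_apply_self E j] at h1
  have h2 := Complex.ofReal_injective h1
  have h3 : (∑ i, ‖E i j‖ ^ 2) ^ 2 ≤ ∑ k, ‖(Eᴴ * E) k j‖ ^ 2 := by
    refine le_trans (le_of_eq ?_) (Finset.single_le_sum (f := fun k => ‖(Eᴴ * E) k j‖ ^ 2)
      (fun k _ => by positivity) (Finset.mem_univ j))
    rw [conjTranspose_mul_self_apply_self E j, Complex.norm_real, Real.norm_eq_abs, sq_abs]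
  have h4 : ∑ i, ‖N i j‖ ^ 2 / m i = ∑ i, ‖E i j‖ ^ 2 := by
    refine Finset.sum_congr rfl fun i _ => ?_
    rw [hE, diagonal_mul, norm_mul, Complex.norm_real, mul_pow, Real.norm_eq_abs, sq_abs, inv_pow,
      Real.sq_sqrt (hm i), div_eq_inv_mul]
  rw [h4]
  nlinarith

/-- The part of the MSE that the digital processing removes, in terms of the whitened combiner `M`
and the noise level `s`. -/
noncomputable def mseReduction {ι κ : Type*} [Fintype ι] [Fintype κ] {G : ℕ}
    (A : Matrix ι κ ℂ) (M : Matrix (Fin G) κ ℂ) (s : ℝ) : ℝ :=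
  (trace (A * Mᴴ * (M * Mᴴ + (s : ℂ) • (1 : Matrix _ _ ℂ))⁻¹ * M * Aᴴ)).re

section

variable {ι κ : Type*} [Fintype ι] [Fintype κ] [DecidableEq κ] {G d : ℕ}
  {A : Matrix ι κ ℂ} {V : Matrix κ (Fin d) ℂ}

/-- The reduction of a combiner `M = W N Vᴴ` with `W`, `V` unitary and `N` having orthogonal rows. -/
lemma mseReduction_eq_sum (hV : IsRightSingularMatrix A V) {W : Matrix (Fin G) (Fin G) ℂ}
    (hW : Wᴴ * W = 1) {N : Matrix (Fin G) (Fin d) ℂ} {m : Fin G → ℝ} (hm : ∀ i, 0 ≤ m i)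
    (hN : N * Nᴴ = diagonal fun i => (m i : ℂ)) {s : ℝ} (hs : 0 < s) :
    mseReduction A (W * N * Vᴴ) s
      = ∑ i, ∑ j : Fin d, ‖N i j‖ ^ 2 / (m i + s) * singVal A j ^ 2 := by
  have hW' : W * Wᴴ = 1 := mul_eq_one_comm.1 hW
  have hMM : (W * N * Vᴴ) * (W * N * Vᴴ)ᴴ = W * (diagonal fun i => (m i : ℂ)) * Wᴴ := by
    rw [← hN]
    simp only [conjTranspose_mul, conjTranspose_conjTranspose, Matrix.mul_assoc]
    rw [← Matrix.mul_assoc Vᴴ, hV.unitary_left, Matrix.one_mul]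
  have hinv : ((W * N * Vᴴ) * (W * N * Vᴴ)ᴴ + (s : ℂ) • (1 : Matrix _ _ ℂ))⁻¹
      = W * (diagonal fun i => (((m i + s)⁻¹ : ℝ) : ℂ)) * Wᴴ := by
    refine Matrix.inv_eq_left_inv ?_
    rw [hMM]
    have h1 : W * (diagonal fun i => (m i : ℂ)) * Wᴴ + (s : ℂ) • (1 : Matrix _ _ ℂ)
        = W * (diagonal fun i => ((m i + s : ℝ) : ℂ)) * Wᴴ := by
      have : (diagonal fun i => ((m i + s : ℝ) : ℂ))
          = (diagonal fun i => (m i : ℂ)) + (s : ℂ) • (1 : Matrix (Fin G) (Fin G) ℂ) := by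
        ext i j
        by_cases h : i = j <;> simp [h]
      rw [this, Matrix.mul_add, Matrix.add_mul, Matrix.mul_smul, Matrix.smul_mul, Matrix.mul_one,
        hW']
    rw [h1]
    simp only [Matrix.mul_assoc]
    rw [← Matrix.mul_assoc Wᴴ, hW, Matrix.one_mul, ← Matrix.mul_assoc (diagonal _),
      diagonal_mul_diagonal]
    have h2 : (fun i => (((m i + s)⁻¹ : ℝ) : ℂ) * ((m i + s : ℝ) : ℂ)) = fun _ => 1 := by
      ext i
      have : m i + s ≠ 0 := (add_pos_of_nonneg_of_pos (hm i) hs).ne'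
      rw [← Complex.ofReal_mul, inv_mul_cancel₀ this, Complex.ofReal_one]
    rw [h2, diagonal_one, Matrix.one_mul, hW']
  rw [mseReduction, hinv]
  have h3 : trace (A * (W * N * Vᴴ)ᴴ * (W * (diagonal fun i => (((m i + s)⁻¹ : ℝ) : ℂ)) * Wᴴ)
        * (W * N * Vᴴ) * Aᴴ)
      = trace ((diagonal fun i => (((m i + s)⁻¹ : ℝ) : ℂ)) *
          (N * (diagonal fun j : Fin d => ((singVal A j ^ 2 : ℝ) : ℂ)) * Nᴴ)) := by
    have hA : Vᴴ * (Aᴴ * A) * V = diagonal fun j : Fin d => ((singVal A j ^ 2 : ℝ) : ℂ) := by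
      rw [Matrix.mul_assoc, hV.right_singular, ← Matrix.mul_assoc, hV.unitary_left, Matrix.one_mul]
    rw [← hA]
    simp only [conjTranspose_mul, conjTranspose_conjTranspose, Matrix.mul_assoc]
    rw [← Matrix.mul_assoc Wᴴ W, hW, Matrix.one_mul, ← Matrix.mul_assoc Wᴴ W, hW, Matrix.one_mul,
      ← Matrix.mul_assoc A, ← Matrix.mul_assoc (A * V), Matrix.trace_mul_comm]
    simp only [Matrix.mul_assoc]
  rw [h3, trace, Complex.re_sum]
  refine Finset.sum_congr rfl fun i _ => ?_
  rw [diag_apply, diagonal_mul, Complex.re_ofReal_mul, Matrix.mul_apply, Complex.re_sum,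
    Finset.mul_sum]
  refine Finset.sum_congr rfl fun j _ => ?_
  rw [mul_diagonal, conjTranspose_apply, mul_right_comm, RCLike.star_def, Complex.mul_conj',
    ← Complex.ofReal_pow, ← Complex.ofReal_mul, Complex.ofReal_re]
  ring

open scoped ComplexOrder in
/-- Singular value decomposition of `M` on the left only: in the coordinates given by `V` on the
right, the rows become orthogonal after a unitary change of coordinates on the left. -/
lemma exists_orthogonal_rows (hV1 : V * Vᴴ = 1) (M : Matrix (Fin G) κ ℂ) :
    ∃ (W : Matrix (Fin G) (Fin G) ℂ) (N : Matrix (Fin G) (Fin d) ℂ) (m : Fin G → ℝ),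
      Wᴴ * W = 1 ∧ (∀ i, 0 ≤ m i) ∧ N * Nᴴ = (diagonal fun i => (m i : ℂ)) ∧ M = W * N * Vᴴ := by
  have hp : (M * Mᴴ).PosSemidef := posSemidef_self_mul_conjTranspose M
  obtain ⟨W, m, hW, hm, hsp⟩ : ∃ (W : Matrix (Fin G) (Fin G) ℂ) (m : Fin G → ℝ), Wᴴ * W = 1 ∧
      (∀ i, 0 ≤ m i) ∧ M * Mᴴ = W * (diagonal fun i => (m i : ℂ)) * Wᴴ := by
    have hsp := hp.1.spectral_theorem
    rw [Unitary.conjStarAlgAut_apply] at hsp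
    refine ⟨hp.1.eigenvectorUnitary.1, hp.1.eigenvalues, ?_, hp.eigenvalues_nonneg, hsp⟩
    rw [← star_eq_conjTranspose]
    exact Unitary.coe_star_mul_self hp.1.eigenvectorUnitary
  have hW' : W * Wᴴ = 1 := mul_eq_one_comm.1 hW
  refine ⟨W, Wᴴ * M * V, m, hW, hm, ?_, ?_⟩
  · simp only [conjTranspose_mul, conjTranspose_conjTranspose, Matrix.mul_assoc]
    rw [← Matrix.mul_assoc V, hV1, Matrix.one_mul, ← Matrix.mul_assoc M, hsp]
    simp only [Matrix.mul_assoc]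
    rw [hW, Matrix.mul_one, ← Matrix.mul_assoc Wᴴ, hW, Matrix.one_mul]
  · simp only [Matrix.mul_assoc]
    rw [hV1, Matrix.mul_one, ← Matrix.mul_assoc, hW', Matrix.one_mul]

lemma singVal_nonneg (A : Matrix ι κ ℂ) (g : ℕ) : 0 ≤ singVal A g :=
  LinearMap.singularValues_nonneg _ _

lemma singVal_antitone (A : Matrix ι κ ℂ) : Antitone (singVal A) :=
  LinearMap.singularValues_antitone _

/-- Upper bound on the reduction of an arbitrary combiner, for every Lagrange multiplier `t ^ 2` of the
power constraint. -/
lemma mseReduction_le (hG0 : 0 < G) (hG : G ≤ d) (hV : IsRightSingularMatrix A V)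
    (M : Matrix (Fin G) κ ℂ) {a s t : ℝ} (ha : 0 < a) (hs : 0 < s) (ht : 0 < t)
    (hM : a * (trace (M * Mᴴ)).re ≤ s) :
    mseReduction A M s ≤ t ^ 2 / a + ∑ g : Fin G, max (singVal A g - t) 0 ^ 2 := by
  obtain ⟨W, N, m, hW, hm, hN, rfl⟩ := exists_orthogonal_rows hV.unitary_right M
  rw [mseReduction_eq_sum hV hW hm hN hs]
  have htr : (trace ((W * N * Vᴴ) * (W * N * Vᴴ)ᴴ)).re = ∑ i, m i := by
    have h1 : trace ((W * N * Vᴴ) * (W * N * Vᴴ)ᴴ) = trace (N * Nᴴ) := by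
      simp only [conjTranspose_mul, conjTranspose_conjTranspose, Matrix.mul_assoc]
      rw [← Matrix.mul_assoc Vᴴ V, hV.unitary_left, Matrix.one_mul, Matrix.trace_mul_comm]
      simp only [Matrix.mul_assoc]
      rw [hW, Matrix.mul_one]
    rw [h1, hN, trace_diagonal, Complex.re_sum]
    simp
  have hrow : ∀ i, ∑ j, ‖N i j‖ ^ 2 = m i := fun i => by
    have := mul_conjTranspose_self_apply_self N i
    rw [hN, diagonal_apply_eq] at this
    exact (Complex.ofReal_injective this).symm
  have hz : ∀ i j, m i = 0 → ‖N i j‖ ^ 2 = 0 := fun i j h =>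
    (Finset.sum_eq_zero_iff_of_nonneg (fun j _ => by positivity)).1 ((hrow i).trans h) j
      (Finset.mem_univ j)
  have hterm : ∀ i (j : Fin d), ‖N i j‖ ^ 2 / (m i + s) * singVal A j ^ 2
      ≤ t ^ 2 / s * ‖N i j‖ ^ 2 + max (singVal A j - t) 0 ^ 2 * (‖N i j‖ ^ 2 / m i) := by
    intro i j
    rcases (hm i).eq_or_lt with h | h
    · simp [hz i j h.symm]
    · have h1 := div_mul_sq_le_waterfilling (t := t) (singVal_nonneg A j) h.le hs
      have h2 := mul_le_mul_of_nonneg_left h1 (show 0 ≤ ‖N i j‖ ^ 2 / m i by positivity)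
      refine le_of_eq_of_le ?_ (h2.trans_eq ?_) <;> field_simp
  have hsum : ∑ i, m i ≤ s / a := by
    rw [le_div_iff₀ ha, mul_comm, ← htr]; exact hM
  calc ∑ i, ∑ j : Fin d, ‖N i j‖ ^ 2 / (m i + s) * singVal A j ^ 2
      ≤ ∑ i, ∑ j : Fin d, (t ^ 2 / s * ‖N i j‖ ^ 2
          + max (singVal A j - t) 0 ^ 2 * (‖N i j‖ ^ 2 / m i)) :=
        Finset.sum_le_sum fun i _ => Finset.sum_le_sum fun j _ => hterm i j
    _ = t ^ 2 / s * ∑ i, m i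
          + ∑ j : Fin d, max (singVal A j - t) 0 ^ 2 * ∑ i, ‖N i j‖ ^ 2 / m i := by
        simp only [Finset.sum_add_distrib, ← Finset.mul_sum, hrow]
        rw [Finset.sum_comm]
        simp only [Finset.mul_sum]
    _ ≤ t ^ 2 / s * (s / a) + ∑ g : Fin G, max (singVal A (Fin.castLE hG g : Fin d) - t) 0 ^ 2 := by
        gcongr
        refine sum_mul_le_sum_castLE hG0 hG (f := fun j : Fin d => max (singVal A j - t) 0 ^ 2) ?_
          (fun j => by positivity)
          (fun j => Finset.sum_nonneg fun i _ => div_nonneg (by positivity) (hm i))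
          (sum_norm_sq_div_le_one hm hN) ?_
        · intro i j hij
          have := singVal_antitone A (show (i : ℕ) ≤ j from hij)
          dsimp only
          gcongr
        · rw [Finset.sum_comm]
          refine (Finset.sum_le_card_nsmul _ _ 1 fun i _ => ?_).trans_eq (by simp)
          rw [← Finset.sum_div, hrow]
          exact div_self_le_one _
    _ = t ^ 2 / a + ∑ g : Fin G, max (singVal A g - t) 0 ^ 2 := by
        simp only [Fin.val_castLE]
        congr 1
        field_simp

end

/-! ### The water-filling design: value and existence -/

section

variable {ι κ : Type*} [Fintype ι] [Fintype κ] [DecidableEq κ] {G d : ℕ}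
  {A : Matrix ι κ ℂ} {V : Matrix κ (Fin d) ℂ}

lemma IsWaterFillingDesign.water_level_pos {hG : G ≤ d} {a ζ : ℝ} {Λ : Matrix (Fin G) (Fin d) ℂ}
    {U : Matrix (Fin G) (Fin G) ℂ} (h : IsWaterFillingDesign hG A a V ζ Λ U) : 0 < ζ := by
  by_contra hζ
  have : ∀ g : Fin G, max (ζ * singVal A g - 1) 0 = 0 := fun g => max_eq_right (by
    have := mul_nonpos_of_nonpos_of_nonneg (not_lt.1 hζ) (singVal_nonneg A g)
    linarith)
  simpa [this] using h.water_level

/-- The water-filling power `a (ζ λ_g - 1)⁺` given to the `g`-th singular direction. -/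
noncomputable def waterPower (A : Matrix ι κ ℂ) (a ζ : ℝ) (g : ℕ) : ℝ :=
  a * max (ζ * singVal A g - 1) 0

lemma waterPower_nonneg {a : ℝ} (ha : 0 < a) (ζ : ℝ) (g : ℕ) : 0 ≤ waterPower A a ζ g := by
  unfold waterPower; positivity

namespace IsWaterFillingDesign

variable {hG : G ≤ d} {a ζ : ℝ} {Λ : Matrix (Fin G) (Fin d) ℂ} {U : Matrix (Fin G) (Fin G) ℂ}

lemma norm_sq_entry (h : IsWaterFillingDesign hG A a V ζ Λ U) (ha : 0 < a) (g : Fin G) :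
    ‖Λ g (Fin.castLE hG g)‖ ^ 2 = waterPower A a ζ g := by
  rw [← norm_pow, h.diagonal_entry, Complex.norm_real, Real.norm_eq_abs]
  exact abs_of_nonneg (waterPower_nonneg ha ζ g)

lemma mul_conjTranspose (h : IsWaterFillingDesign hG A a V ζ Λ U) (ha : 0 < a) :
    Λ * Λᴴ = diagonal fun g : Fin G => (waterPower A a ζ g : ℂ) := by
  ext g k
  rw [Matrix.mul_apply, Finset.sum_eq_single (Fin.castLE hG g)
    (fun j _ hj => by rw [h.off_diagonal g j hj, zero_mul]) (by simp), conjTranspose_apply]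
  rcases eq_or_ne g k with rfl | hgk
  · rw [diagonal_apply_eq, RCLike.star_def, Complex.mul_conj', ← Complex.ofReal_pow,
      h.norm_sq_entry ha]
  · rw [diagonal_apply_ne _ hgk, h.off_diagonal k _ (by simpa using hgk), star_zero, mul_zero]

lemma conjTranspose_mul_unitary (h : IsWaterFillingDesign hG A a V ζ Λ U) : Uᴴ * U = 1 :=
  (Matrix.mem_unitaryGroup_iff').1 h.unitary

/-- The equalising rotation spreads the total power `1` evenly over the `G` ADC inputs. -/
lemma diag_apply_eq (h : IsWaterFillingDesign hG A a V ζ Λ U) (hG0 : 0 < G) (ha : 0 < a)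
    (g : Fin G) : (U * Λ * Λᴴ * Uᴴ) g g = ((1 / G : ℝ) : ℂ) := by
  have h1 : trace (U * Λ * Λᴴ * Uᴴ) = 1 := by
    rw [Matrix.mul_assoc U, h.mul_conjTranspose ha, trace_mul_cycle, h.conjTranspose_mul_unitary,
      Matrix.one_mul, trace_diagonal, ← Complex.ofReal_sum, ← Complex.ofReal_one, ← h.water_level,
      Finset.mul_sum]
    rfl
  have h2 : trace (U * Λ * Λᴴ * Uᴴ) = G * (U * Λ * Λᴴ * Uᴴ) g g := by
    simp only [trace, diag_apply]
    rw [Finset.sum_congr rfl fun k _ => h.equal_diagonal k g]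
    simp
  have hG' : (G : ℂ) ≠ 0 := by exact_mod_cast hG0.ne'
  rw [h1] at h2
  push_cast
  field_simp
  rw [h2]
  ring

/-- The water-filling design attains the bound of `mseReduction_le` with multiplier `ζ⁻¹ ^ 2`. -/
lemma mseReduction_eq (h : IsWaterFillingDesign hG A a V ζ Λ U) (ha : 0 < a) :
    mseReduction A (U * Λ * Vᴴ) a
      = ζ⁻¹ ^ 2 / a + ∑ g : Fin G, max (singVal A g - ζ⁻¹) 0 ^ 2 := by
  have hζ := h.water_level_pos
  rw [mseReduction_eq_sum h.right_singular h.conjTranspose_mul_unitary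
    (fun g => waterPower_nonneg (A := A) ha ζ (g : Fin G)) (h.mul_conjTranspose ha) ha]
  have h1 : ζ⁻¹ ^ 2 / a = ∑ g : Fin G, ζ⁻¹ ^ 2 * max (ζ * singVal A g - 1) 0 := by
    rw [← Finset.mul_sum, eq_div_of_mul_eq ha.ne' ((mul_comm _ _).trans h.water_level)]
    ring
  rw [h1, ← Finset.sum_add_distrib]
  refine Finset.sum_congr rfl fun g _ => ?_
  rw [Finset.sum_eq_single (Fin.castLE hG g)
    (fun j _ hj => by rw [h.off_diagonal g j hj]; simp) (by simp), h.norm_sq_entry ha,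
    Fin.val_castLE, waterPower]
  rcases le_total (ζ * singVal A g) 1 with hl | hl
  · have h2 : singVal A g ≤ ζ⁻¹ := by rwa [← one_div, le_div_iff₀' hζ]
    rw [max_eq_right (by linarith), max_eq_right (by linarith)]
    simp
  · have h2 : ζ⁻¹ ≤ singVal A g := by rwa [inv_le_iff_one_le_mul₀' hζ]
    have h3 : singVal A g ≠ 0 := by rintro h0; norm_num [h0] at hl
    rw [max_eq_left (by linarith), max_eq_left (by linarith)]
    have h4 : a * (ζ * singVal A g - 1) + a = a * ζ * singVal A g := by ring
    rw [h4]
    field_simp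
    ring

end IsWaterFillingDesign

lemma exists_isRightSingularMatrix (A : Matrix ι κ ℂ) (hd : Fintype.card κ = d) :
    ∃ V : Matrix κ (Fin d) ℂ, IsRightSingularMatrix A V := by
  classical
  set T := Matrix.toEuclideanLin A
  have hn : Module.finrank ℂ (EuclideanSpace ℂ κ) = d := by simp [hd]
  set b := T.isSymmetric_adjoint_comp_self.eigenvectorBasis hn
  have hadj : T.adjoint = Matrix.toEuclideanLin Aᴴ := (Matrix.toEuclideanLin_conjTranspose_eq_adjoint A).symm
  set V : Matrix κ (Fin d) ℂ := Matrix.of fun k j => b j k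
  have hV : Vᴴ * V = 1 := by
    ext i j
    have := b.inner_eq_ite i j
    simp only [PiLp.inner_apply, RCLike.inner_apply] at this
    simp only [Matrix.mul_apply, conjTranspose_apply, V, of_apply, Matrix.one_apply, ← this]
    exact Finset.sum_congr rfl fun k _ => mul_comm _ _
  refine ⟨V, hV, (Matrix.mul_eq_one_comm_of_card_eq (Fin d) κ ℂ (by simp [hd])).1 hV, ?_⟩
  ext k j
  have h1 : (T.adjoint ∘ₗ T) (b j) = _ := T.isSymmetric_adjoint_comp_self.apply_eigenvectorBasis hn j
  change _ = _ • b j at h1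
  clear_value b
  rw [← T.sq_singularValues_fin hn, LinearMap.comp_apply, hadj] at h1
  have h2 := congrArg (fun x : EuclideanSpace ℂ κ => x k) h1
  rw [mul_diagonal, Matrix.mul_assoc]
  simp only [T, Matrix.toLpLin_apply, PiLp.smul_apply] at h2
  have h3 : (Aᴴ * (A * V)) k j = (Aᴴ *ᵥ (A *ᵥ (b j).ofLp)) k := rfl
  rw [h3]
  refine h2.trans ?_
  rw [mul_comm]
  rfl

lemma singVal_zero_pos {A : Matrix ι κ ℂ} (hA : A ≠ 0) : 0 < singVal A 0 := by
  refine (LinearMap.singularValues_pos_iff_lt_finrank_range _).2 ?_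
  rw [Module.finrank_pos_iff, Submodule.nontrivial_iff_ne_bot, Ne, LinearMap.range_eq_bot]
  simpa using hA

lemma exists_water_level {A : Matrix ι κ ℂ} (hA : A ≠ 0) (hG0 : 0 < G) {a : ℝ} (ha : 0 < a) :
    ∃ ζ : ℝ, a * ∑ g : Fin G, max (ζ * singVal A g - 1) 0 = 1 := by
  have hl := singVal_zero_pos hA
  set f : ℝ → ℝ := fun ζ => a * ∑ g : Fin G, max (ζ * singVal A g - 1) 0
  have hf : Continuous f := by fun_prop
  set b := (1 / a + 1) / singVal A 0
  have h0 : f 0 = 0 := by simp [f]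
  have h1 : 1 ≤ f b := by
    have h2 : 1 / a ≤ ∑ g : Fin G, max (b * singVal A g - 1) 0 := by
      refine le_trans ?_ (Finset.single_le_sum (f := fun g : Fin G => max (b * singVal A g - 1) 0)
        (fun _ _ => le_max_right _ _) (Finset.mem_univ ⟨0, hG0⟩))
      refine le_trans (le_of_eq ?_) (le_max_left _ _)
      simp only [b]
      field_simp
      ring
    calc (1 : ℝ) = a * (1 / a) := by field_simp
      _ ≤ f b := by simp only [f]; gcongr
  obtain ⟨ζ, -, hζ⟩ := intermediate_value_Icc (show (0 : ℝ) ≤ b by positivity) hf.continuousOn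
    (show (1 : ℝ) ∈ Set.Icc (f 0) (f b) from ⟨by rw [h0]; exact zero_le_one, h1⟩)
  exact ⟨ζ, hζ⟩

/-- The normalised discrete Fourier transform is unitary with entries of equal modulus. -/
lemma exists_unitary_norm_sq_entry_eq (hG0 : 0 < G) :
    ∃ U ∈ Matrix.unitaryGroup (Fin G) ℂ, ∀ g h, ‖U g h‖ ^ 2 = 1 / G := by
  have hG' : (G : ℂ) ≠ 0 := by exact_mod_cast hG0.ne'
  set w : ℂ := Complex.exp (2 * Real.pi * Complex.I / G)
  have hw : IsPrimitiveRoot w G := Complex.isPrimitiveRoot_exp G hG0.ne'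
  have hw0 : w ≠ 0 := Complex.exp_ne_zero _
  have hw1 : ‖w‖ = 1 := hw.norm'_eq_one hG0.ne'
  have hconj : star w = w⁻¹ := by
    rw [RCLike.star_def, Complex.inv_def, Complex.normSq_eq_norm_sq, hw1]; simp
  set U : Matrix (Fin G) (Fin G) ℂ :=
    Matrix.of fun g h => ((√(1 / G : ℝ) : ℝ) : ℂ) * w ^ ((g : ℕ) * (h : ℕ))
  have hsq : ((√(1 / G : ℝ) : ℝ) : ℂ) * ((√(1 / G : ℝ) : ℝ) : ℂ) = 1 / G := by
    rw [← Complex.ofReal_mul, Real.mul_self_sqrt (by positivity)]; simp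
  refine ⟨U, Matrix.mem_unitaryGroup_iff.2 ?_, fun g h => ?_⟩
  · ext g k
    rw [star_eq_conjTranspose, Matrix.mul_apply]
    have h1 : ∀ j : Fin G, U g j * Uᴴ j k = 1 / G * (w ^ (g : ℕ) * w⁻¹ ^ (k : ℕ)) ^ (j : ℕ) := by
      intro j
      simp only [conjTranspose_apply, U, of_apply, star_mul', star_pow, hconj]
      rw [← hsq, mul_pow, ← pow_mul, ← pow_mul, RCLike.star_def, Complex.conj_ofReal]
      ring
    rw [Finset.sum_congr rfl fun j _ => h1 j, ← Finset.mul_sum,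
      Fin.sum_univ_eq_sum_range (fun j => (w ^ (g : ℕ) * w⁻¹ ^ (k : ℕ)) ^ j)]
    rcases eq_or_ne g k with rfl | hgk
    · rw [← mul_pow, mul_inv_cancel₀ hw0]
      simp [hG']
    · have hne : w ^ (g : ℕ) * w⁻¹ ^ (k : ℕ) ≠ 1 := by
        rw [inv_pow, Ne, mul_inv_eq_one₀ (pow_ne_zero _ hw0)]
        intro he
        exact hgk (Fin.ext (hw.pow_inj g.2 k.2 he))
      rw [Matrix.one_apply_ne hgk, geom_sum_eq hne, mul_pow, ← pow_mul, ← pow_mul, mul_comm (g : ℕ),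
        mul_comm (k : ℕ), pow_mul, pow_mul, inv_pow, hw.pow_eq_one]
      simp
  · simp only [U, of_apply, norm_mul, norm_pow, hw1, one_pow, mul_one, Complex.norm_real,
      Real.norm_eq_abs, sq_abs]
    exact Real.sq_sqrt (by positivity)

/-- Any unitary matrix with entries of equal modulus equalises the diagonal of `U Λ Λᴴ Uᴴ`, since
`Λ Λᴴ` is diagonal. -/
lemma exists_isWaterFillingDesign {A : Matrix ι κ ℂ} (hA : A ≠ 0) (hd : Fintype.card κ = d)
    (hG0 : 0 < G) (hG : G ≤ d) {a : ℝ} (ha : 0 < a) :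
    ∃ (V : Matrix κ (Fin d) ℂ) (ζ : ℝ) (Λ : Matrix (Fin G) (Fin d) ℂ)
      (U : Matrix (Fin G) (Fin G) ℂ), IsWaterFillingDesign hG A a V ζ Λ U := by
  obtain ⟨V, hV⟩ := exists_isRightSingularMatrix A hd
  obtain ⟨ζ, hζ⟩ := exists_water_level hA hG0 ha
  obtain ⟨U, hU, hUn⟩ := exists_unitary_norm_sq_entry_eq hG0
  set Λ : Matrix (Fin G) (Fin d) ℂ := Matrix.of fun g j =>
    if j = Fin.castLE hG g then ((√(waterPower A a ζ g) : ℝ) : ℂ) else 0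
  have hΛ : Λ * Λᴴ = diagonal fun g : Fin G => (waterPower A a ζ g : ℂ) := by
    ext g k
    have h0 : (√(waterPower A a ζ k) : ℂ) * (√(waterPower A a ζ k) : ℂ) = waterPower A a ζ k := by
      rw [← Complex.ofReal_mul, Real.mul_self_sqrt (waterPower_nonneg ha _ _)]
    by_cases h : g = k
    · subst h
      simp [Λ, Matrix.mul_apply, h0]
    · simp [Λ, Matrix.mul_apply, h, diagonal_apply_ne]
  refine ⟨V, ζ, Λ, U, hV, hζ, fun g j hj => by simp [Λ, hj], fun g => ?_, hU, ?_⟩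
  · simp only [Λ, of_apply, if_true]
    rw [← Complex.ofReal_pow, Real.sq_sqrt (waterPower_nonneg ha _ _), waterPower]
  · have key : ∀ g, (U * Λ * Λᴴ * Uᴴ) g g = 1 / G * ∑ k : Fin G, (waterPower A a ζ k : ℂ) := by
      intro g
      rw [Matrix.mul_assoc U, hΛ, Matrix.mul_apply, Finset.mul_sum]
      refine Finset.sum_congr rfl fun k _ => ?_
      rw [mul_diagonal, conjTranspose_apply, mul_right_comm, RCLike.star_def, Complex.mul_conj',
        ← Complex.ofReal_pow, hUn]
      simp
    intro g h
    rw [key, key]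

end

/-! ### Second moments of complex random vectors and the MMSE estimate -/

section

variable {Ω : Type*} [MeasurableSpace Ω] {μ : Measure Ω} {ι κ ι' κ' : Type*}

lemma memLp_mulVec [Fintype ι] {u : Ω → ι → ℂ} (hu : ∀ i, MemLp (fun ω => u ω i) 2 μ)
    (P : Matrix ι' ι ℂ) (i : ι') : MemLp (fun ω => (P *ᵥ u ω) i) 2 μ := by
  simp only [mulVec, dotProduct]
  exact memLp_finsetSum _ fun k _ => (hu k).const_mul _

lemma integrable_mul_star {f g : Ω → ℂ} (hf : MemLp f 2 μ) (hg : MemLp g 2 μ) :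
    Integrable (fun ω => f ω * star (g ω)) μ :=
  hf.integrable_mul hg.star

lemma crossMoment_mulVec [Fintype ι] [Fintype κ] {u : Ω → ι → ℂ} {v : Ω → κ → ℂ}
    (hu : ∀ i, MemLp (fun ω => u ω i) 2 μ) (hv : ∀ i, MemLp (fun ω => v ω i) 2 μ)
    (P : Matrix ι' ι ℂ) (Q : Matrix κ' κ ℂ) :
    crossMoment μ (fun ω => P *ᵥ u ω) (fun ω => Q *ᵥ v ω) = P * crossMoment μ u v * Qᴴ := by
  ext i j
  have h1 : ∀ ω, (P *ᵥ u ω) i * star ((Q *ᵥ v ω) j)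
      = ∑ l, ∑ k, (P i k * star (Q j l)) * (u ω k * star (v ω l)) := by
    intro ω
    simp only [mulVec, dotProduct, star_sum, star_mul', Finset.sum_mul_sum]
    rw [Finset.sum_comm]
    exact Finset.sum_congr rfl fun l _ => Finset.sum_congr rfl fun k _ => by ring
  simp only [crossMoment, of_apply, h1]
  have hi : ∀ l k, Integrable (fun ω => (P i k * star (Q j l)) * (u ω k * star (v ω l))) μ :=
    fun l k => (integrable_mul_star (hu k) (hv l)).const_mul _
  rw [integral_finsetSum _ fun l _ => integrable_finsetSum _ fun k _ => hi l k, Matrix.mul_apply]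
  refine Finset.sum_congr rfl fun l _ => ?_
  rw [integral_finsetSum _ fun k _ => hi l k, Matrix.mul_apply, Finset.sum_mul]
  refine Finset.sum_congr rfl fun k _ => ?_
  rw [integral_const_mul, of_apply, conjTranspose_apply]
  ring

lemma integral_mul_star_self (f : Ω → ℂ) :
    ∫ ω, f ω * star (f ω) ∂μ = ((∫ ω, ‖f ω‖ ^ 2 ∂μ : ℝ) : ℂ) := by
  rw [← integral_complex_ofReal]
  congr 1
  ext ω
  rw [RCLike.star_def, Complex.mul_conj']
  push_cast
  rfl

lemma integral_sum_norm_sq [Fintype ι] {u : Ω → ι → ℂ} (hu : ∀ i, MemLp (fun ω => u ω i) 2 μ) :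
    ∫ ω, ∑ i, ‖u ω i‖ ^ 2 ∂μ = (trace (crossMoment μ u u)).re := by
  rw [integral_finsetSum _ fun i _ => (hu i).integrable_norm_pow two_ne_zero, trace,
    Complex.re_sum]
  refine Finset.sum_congr rfl fun i _ => ?_
  rw [diag_apply, crossMoment, of_apply, integral_mul_star_self, Complex.ofReal_re]

lemma conjTranspose_crossMoment (u : Ω → ι → ℂ) (v : Ω → κ → ℂ) :
    (crossMoment μ u v)ᴴ = crossMoment μ v u := by
  ext i j
  simp only [conjTranspose_apply, crossMoment, of_apply, RCLike.star_def]
  rw [← integral_conj]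
  simp [mul_comm]

lemma crossMoment_sumElim (u : Ω → ι → ℂ) (v : Ω → κ → ℂ) (u' : Ω → ι' → ℂ) (v' : Ω → κ' → ℂ) :
    crossMoment μ (fun ω => Sum.elim (u ω) (v ω)) (fun ω => Sum.elim (u' ω) (v' ω))
      = fromBlocks (crossMoment μ u u') (crossMoment μ u v')
        (crossMoment μ v u') (crossMoment μ v v') := by
  ext (i | i) (j | j) <;> rfl

/-- A real-linear functional on `ℂ^ι` is the real part of a complex-linear one. -/
lemma exists_strongDual_eq_re_dotProduct [Fintype ι] (L : StrongDual ℝ (ι → ℂ)) :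
    ∃ a : ι → ℂ, ∀ x, L x = (a ⬝ᵥ x).re := by
  classical
  refine ⟨fun i => L (Pi.single i 1) - Complex.I * L (Pi.single i Complex.I), fun x => ?_⟩
  have hx : x = ∑ i, ((x i).re • Pi.single (M := fun _ => ℂ) i 1
      + (x i).im • Pi.single (M := fun _ => ℂ) i Complex.I) := by
    have h1 : ∀ i, (x i).re • Pi.single (M := fun _ => ℂ) i 1
      + (x i).im • Pi.single (M := fun _ => ℂ) i Complex.I = Pi.single i (x i) := by
      intro i
      rw [← Pi.single_smul, ← Pi.single_smul, ← Pi.single_add]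
      congr 1
      simp [Complex.re_add_im]
    simp only [h1, Finset.univ_sum_single]
  conv_lhs => rw [hx]
  simp only [map_sum, map_add, map_smul, smul_eq_mul, dotProduct, Complex.re_sum]
  refine Finset.sum_congr rfl fun i _ => ?_
  simp [Complex.mul_re]
  ring

/-- Zero-mean jointly Gaussian complex vectors are independent as soon as both `E[X Yᴴ]` and
`E[X Yᵀ]` vanish. -/
lemma indepFun_of_crossMoment_eq_zero [Fintype ι] [Fintype κ] {X : Ω → ι → ℂ} {Y : Ω → κ → ℂ}
    (hXY : HasGaussianLaw (fun ω => (X ω, Y ω)) μ) (hX : ∀ i, ∫ ω, X ω i ∂μ = 0)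
    (hcov : crossMoment μ X Y = 0) (hpseudo : crossMoment μ X (fun ω => star (Y ω)) = 0) :
    IndepFun X Y μ := by
  have := hXY.isProbabilityMeasure
  have hXi : ∀ i, MemLp (fun ω => X ω i) 2 μ := fun i => (hXY.fst.eval i).memLp_two
  have hYi : ∀ i, MemLp (fun ω => Y ω i) 2 μ := fun i => (hXY.snd.eval i).memLp_two
  refine hXY.indepFun_of_covariance_strongDual fun L₁ L₂ => ?_
  obtain ⟨a, ha⟩ := exists_strongDual_eq_re_dotProduct L₁
  obtain ⟨b, hb⟩ := exists_strongDual_eq_re_dotProduct L₂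
  have hXint : ∫ ω, X ω ∂μ = 0 := by
    ext i
    rw [eval_integral fun i => (hXi i).integrable one_le_two, hX]
    rfl
  have hm : ∫ ω, (L₁ ∘ X) ω ∂μ = 0 := by
    simp only [Function.comp_apply]
    rw [ContinuousLinearMap.integral_comp_comm _ hXY.fst.integrable, hXint, map_zero]
  rw [covariance_eq_sub (hXY.fst.map L₁).memLp_two (hXY.snd.map L₂).memLp_two, hm, zero_mul,
    sub_zero]
  set U : Ω → ℂ := fun ω => a ⬝ᵥ X ω
  set V : Ω → ℂ := fun ω => b ⬝ᵥ Y ω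
  have hU : MemLp U 2 μ := memLp_mulVec hXi (Matrix.of fun _ : Unit => a) ()
  have hV : MemLp V 2 μ := memLp_mulVec hYi (Matrix.of fun _ : Unit => b) ()
  have h1 : ∫ ω, U ω * star (V ω) ∂μ = 0 := by
    have := crossMoment_mulVec hXi hYi (Matrix.of fun _ : Unit => a) (Matrix.of fun _ : Unit => b)
    rw [hcov, Matrix.mul_zero, Matrix.zero_mul] at this
    exact congrFun (congrFun this ()) ()
  have h2 : ∫ ω, U ω * V ω ∂μ = 0 := by
    have := crossMoment_mulVec hXi (fun i => (hYi i).star) (Matrix.of fun _ : Unit => a)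
      (Matrix.of fun _ : Unit => star b)
    have h3 : crossMoment μ X (fun ω i => star (Y ω i)) = 0 := hpseudo
    simp only [Pi.star_def, h3, Matrix.mul_zero, Matrix.zero_mul] at this
    have h4 := congrFun (congrFun this ()) ()
    rw [Matrix.zero_apply] at h4
    rw [← h4]
    simp only [crossMoment, of_apply]
    congr 1
    ext ω
    congr 1
    simp [V, mulVec, dotProduct]
  have h3 : ∀ ω, (L₁ ∘ X * L₂ ∘ Y) ω = 1 / 2 * (U ω * star (V ω) + U ω * V ω).re := by
    intro ω
    simp only [Pi.mul_apply, Function.comp_apply, ha, hb, Complex.add_re, Complex.mul_re,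
      RCLike.star_def, Complex.conj_re, Complex.conj_im, U, V]
    ring
  have hi1 := integrable_mul_star hU hV
  have hi2 : Integrable (fun ω => U ω * V ω) μ := hU.integrable_mul hV
  simp only [h3]
  rw [integral_const_mul]
  have h5 : ∫ ω, (U ω * star (V ω) + U ω * V ω).re ∂μ
      = (∫ ω, (U ω * star (V ω) + U ω * V ω) ∂μ).re := integral_re (hi1.add hi2)
  rw [h5, integral_add hi1 hi2, h1, h2]
  simp

lemma mulVec_measurable [Fintype ι] (P : Matrix ι' ι ℂ) : Measurable fun x : ι → ℂ => P *ᵥ x := by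
  refine measurable_pi_lambda _ fun i => ?_
  simp only [mulVec, dotProduct]
  fun_prop

/-- For zero-mean jointly Gaussian vectors that are jointly circular, the MMSE estimate is the
linear one: the estimation error is uncorrelated with, hence independent of, the observation. -/
lemma mmse_ae_eq_linearEstimator [Fintype ι] [Fintype κ] [DecidableEq κ] {c : Ω → ι → ℂ}
    {y : Ω → κ → ℂ} (hcm : Measurable c) (hym : Measurable y)
    (hcy : HasGaussianLaw (fun ω => (c ω, y ω)) μ)
    (hc0 : ∀ i, ∫ ω, c ω i ∂μ = 0) (hy0 : ∀ i, ∫ ω, y ω i ∂μ = 0)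
    (hpc : crossMoment μ c (fun ω => star (y ω)) = 0)
    (hpy : crossMoment μ y (fun ω => star (y ω)) = 0)
    (hdet : IsUnit (crossMoment μ y y).det) :
    mmse μ c y =ᵐ[μ] fun ω => linearEstimator μ c y *ᵥ y ω := by
  classical
  have := hcy.isProbabilityMeasure
  set Γ := linearEstimator μ c y with hΓ
  have hci : ∀ i, MemLp (fun ω => c ω i) 2 μ := fun i => (hcy.fst.eval i).memLp_two
  have hyi : ∀ i, MemLp (fun ω => y ω i) 2 μ := fun i => (hcy.snd.eval i).memLp_two
  have hzi : ∀ i, MemLp (fun ω => Sum.elim (c ω) (y ω) i) 2 μ := by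
    rintro (i | i)
    exacts [hci i, hyi i]
  set X : Ω → ι → ℂ := fun ω => c ω - Γ *ᵥ y ω with hX
  have hXz : X = fun ω => fromCols 1 (-Γ) *ᵥ Sum.elim (c ω) (y ω) := by
    ext ω i
    simp [hX, fromCols_mulVec, neg_mulVec, sub_eq_add_neg]
  have hXm : Measurable X := hcm.sub ((mulVec_measurable Γ).comp hym)
  have hXc : crossMoment μ X y = 0 := by
    have h1 := crossMoment_mulVec hzi hzi (fromCols 1 (-Γ)) (fromCols (0 : Matrix κ ι ℂ) 1)
    have h2 : (fun ω => fromCols (0 : Matrix κ ι ℂ) 1 *ᵥ Sum.elim (c ω) (y ω)) = y := by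
      ext ω i
      simp [fromCols_mulVec]
    rw [h2, ← hXz, crossMoment_sumElim, fromCols_mul_fromBlocks,
      conjTranspose_fromCols_eq_fromRows_conjTranspose, fromCols_mul_fromRows] at h1
    simp only [conjTranspose_zero, conjTranspose_one, Matrix.mul_zero, Matrix.mul_one, zero_add,
      Matrix.one_mul] at h1
    rw [h1, Matrix.neg_mul, hΓ, linearEstimator, Matrix.mul_assoc, nonsing_inv_mul _ hdet,
      Matrix.mul_one, add_neg_cancel]
  have hXp : crossMoment μ X (fun ω => star (y ω)) = 0 := by
    have h1 := crossMoment_mulVec (v := fun ω => star (y ω)) hzi (fun i => (hyi i).star)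
      (fromCols 1 (-Γ)) (1 : Matrix κ κ ℂ)
    have h3 : crossMoment μ (fun ω => Sum.elim (c ω) (y ω)) (fun ω => star (y ω)) = 0 := by
      ext (i | i) j
      · exact congrFun (congrFun hpc i) j
      · exact congrFun (congrFun hpy i) j
    simp only [one_mulVec] at h1
    rwa [← hXz, h3, Matrix.mul_zero, Matrix.zero_mul] at h1
  have hX0 : ∀ i, ∫ ω, X ω i ∂μ = 0 := by
    intro i
    have h1 : ∀ k, Integrable (fun ω => Γ i k * y ω k) μ := fun k =>
      ((hyi k).integrable one_le_two).const_mul _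
    simp only [hX, Pi.sub_apply, mulVec, dotProduct]
    rw [integral_sub ((hci i).integrable one_le_two) (integrable_finsetSum _ fun k _ => h1 k),
      integral_finsetSum _ fun k _ => h1 k]
    simp [integral_const_mul, hc0, hy0]
  have hG : HasGaussianLaw (fun ω => (X ω, y ω)) μ := by
    let F : (ι → ℂ) × (κ → ℂ) →ₗ[ℝ] (ι → ℂ) × (κ → ℂ) :=
      (LinearMap.fst ℝ _ _ - (Γ.mulVecLin.restrictScalars ℝ) ∘ₗ LinearMap.snd ℝ _ _).prod
        (LinearMap.snd ℝ _ _)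
    exact hcy.map F.toContinuousLinearMap
  have hind : IndepFun X y μ := indepFun_of_crossMoment_eq_zero hG hX0 hXc hXp
  have hXint : ∫ ω, X ω ∂μ = 0 := by
    ext i
    rw [eval_integral fun i => (hG.fst.eval i).integrable, hX0]
    rfl
  have hle : MeasurableSpace.comap y inferInstance ≤ ‹MeasurableSpace Ω› := hym.comap_le
  have hleX : MeasurableSpace.comap X inferInstance ≤ ‹MeasurableSpace Ω› := hXm.comap_le
  have e1 : μ[X | MeasurableSpace.comap y inferInstance] =ᵐ[μ] fun _ => μ[X] :=
    condExp_indep_eq hleX hle (comap_measurable X).stronglyMeasurable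
      ((IndepFun_iff_Indep _ _ _).1 hind)
  have hΓy : Integrable (fun ω => Γ *ᵥ y ω) μ :=
    Integrable.of_eval fun i => (memLp_mulVec hyi Γ i).integrable one_le_two
  have e2 : μ[fun ω => Γ *ᵥ y ω | MeasurableSpace.comap y inferInstance] = fun ω => Γ *ᵥ y ω :=
    condExp_of_stronglyMeasurable hle
      ((mulVec_measurable Γ).comp (comap_measurable y)).stronglyMeasurable hΓy
  have e3 := condExp_add hG.fst.integrable hΓy (MeasurableSpace.comap y inferInstance)
  have e4 : X + (fun ω => Γ *ᵥ y ω) = c := by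
    ext ω i
    simp [hX]
  rw [e4, e2] at e3
  filter_upwards [e3, e1] with ω h1 h2
  rw [mmse, h1, Pi.add_apply, h2, hXint, zero_add]

end

/-! ### ADC support and distortion -/

section

/-- The uniform law on `[-1/2, 1/2]`, of which `ditherLaw` is built, has mass `1`. -/
instance : IsProbabilityMeasure (volume.restrict (Set.Icc (-1 / 2 : ℝ) (1 / 2))) :=
  ⟨by rw [Measure.restrict_apply_univ, Real.volume_Icc]; norm_num⟩

lemma measurable_dither (Δ : ℝ) : Measurable fun p : ℝ × ℝ => (⟨Δ * p.1, Δ * p.2⟩ : ℂ) := by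
  have : (fun p : ℝ × ℝ => (⟨Δ * p.1, Δ * p.2⟩ : ℂ))
      = fun p : ℝ × ℝ => ((Δ * p.1 : ℝ) : ℂ) + ((Δ * p.2 : ℝ) : ℂ) * Complex.I := by
    ext p
    apply Complex.ext <;> simp
  rw [this]
  fun_prop

instance (Δ : ℝ) : IsProbabilityMeasure (ditherLaw Δ) :=
  Measure.isProbabilityMeasure_map (measurable_dither Δ).aemeasurable

lemma integrable_pow_unitInterval (k : ℕ) :
    Integrable (fun x : ℝ => x ^ k) (volume.restrict (Set.Icc (-1 / 2 : ℝ) (1 / 2))) :=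
  (continuous_pow k).continuousOn.integrableOn_Icc

lemma integral_unitInterval : ∫ x in Set.Icc (-1 / 2 : ℝ) (1 / 2), x = 0 := by
  rw [integral_Icc_eq_integral_Ioc, ← intervalIntegral.integral_of_le (by norm_num), integral_id]
  norm_num

lemma integral_sq_unitInterval : ∫ x in Set.Icc (-1 / 2 : ℝ) (1 / 2), x ^ 2 = 1 / 12 := by
  rw [integral_Icc_eq_integral_Ioc, ← intervalIntegral.integral_of_le (by norm_num), integral_pow]
  norm_num

lemma norm_sq_dither (Δ : ℝ) (p : ℝ × ℝ) :
    ‖(⟨Δ * p.1, Δ * p.2⟩ : ℂ)‖ ^ 2 = Δ ^ 2 * p.1 ^ 2 + Δ ^ 2 * p.2 ^ 2 := by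
  rw [Complex.sq_norm, Complex.normSq_mk]
  ring

lemma memLp_dither (Δ : ℝ) : MemLp (fun z : ℂ => z) 2 (ditherLaw Δ) := by
  rw [ditherLaw, memLp_map_measure_iff (by fun_prop) (measurable_dither Δ).aemeasurable,
    memLp_two_iff_integrable_sq_norm (by exact (measurable_dither Δ).aestronglyMeasurable)]
  simp only [Function.comp_def, norm_sq_dither]
  exact (((integrable_pow_unitInterval 2).comp_fst _).const_mul _).add
    (((integrable_pow_unitInterval 2).comp_snd _).const_mul _)

lemma integral_dither_norm_sq (Δ : ℝ) : ∫ z, ‖z‖ ^ 2 ∂ditherLaw Δ = Δ ^ 2 / 6 := by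
  rw [ditherLaw, integral_map (measurable_dither Δ).aemeasurable (by fun_prop)]
  simp only [norm_sq_dither]
  rw [integral_add (((integrable_pow_unitInterval 2).comp_fst _).const_mul _)
    (((integrable_pow_unitInterval 2).comp_snd _).const_mul _), integral_const_mul,
    integral_const_mul, integral_fun_fst (fun x : ℝ => x ^ 2),
    integral_fun_snd (fun x : ℝ => x ^ 2), integral_sq_unitInterval]
  simp only [probReal_univ, one_smul]
  ring

lemma integral_dither (Δ : ℝ) : ∫ z, z ∂ditherLaw Δ = 0 := by
  have hi : Integrable (fun z : ℂ => z) (ditherLaw Δ) := (memLp_dither Δ).integrable one_le_two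
  apply Complex.ext
  · refine (integral_re hi).symm.trans ?_
    simp only [RCLike.re_eq_complex_re]
    rw [ditherLaw, integral_map (measurable_dither Δ).aemeasurable
      (Complex.measurable_re.aestronglyMeasurable)]
    simp only
    rw [integral_const_mul, integral_fun_fst (fun x : ℝ => x), integral_unitInterval]
    simp
  · refine (integral_im hi).symm.trans ?_
    simp only [RCLike.im_eq_complex_im]
    rw [ditherLaw, integral_map (measurable_dither Δ).aemeasurable
      (Complex.measurable_im.aestronglyMeasurable)]
    simp only
    rw [integral_const_mul, integral_fun_snd (fun x : ℝ => x), integral_unitInterval]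
    simp

variable {Ω : Type*} [MeasurableSpace Ω] {μ : Measure Ω}

lemma integral_norm_add_sq_prod [IsProbabilityMeasure μ] {α : Type*} [MeasurableSpace α] {ν : Measure α}
    [IsProbabilityMeasure ν] {u : Ω → ℂ} {z : α → ℂ} (hu : MemLp u 2 μ) (hz : MemLp z 2 ν)
    (hz0 : ∫ x, z x ∂ν = 0) :
    ∫ p : Ω × α, ‖u p.1 + z p.2‖ ^ 2 ∂(μ.prod ν) = ∫ ω, ‖u ω‖ ^ 2 ∂μ + ∫ x, ‖z x‖ ^ 2 ∂ν := by
  have h1 : ∀ p : Ω × α, ‖u p.1 + z p.2‖ ^ 2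
      = ‖u p.1‖ ^ 2 + ‖z p.2‖ ^ 2 + 2 * (u p.1 * star (z p.2)).re := by
    intro p
    simp only [Complex.sq_norm, Complex.normSq_add, RCLike.star_def]
  have hi1 : Integrable (fun p : Ω × α => ‖u p.1‖ ^ 2) (μ.prod ν) :=
    (hu.integrable_norm_pow two_ne_zero).comp_fst ν
  have hi2 : Integrable (fun p : Ω × α => ‖z p.2‖ ^ 2) (μ.prod ν) :=
    (hz.integrable_norm_pow two_ne_zero).comp_snd μ
  have hi3 : Integrable (fun p : Ω × α => u p.1 * star (z p.2)) (μ.prod ν) :=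
    (hu.integrable one_le_two).mul_prod (hz.star.integrable one_le_two)
  have hi4 : Integrable (fun p : Ω × α => (u p.1 * star (z p.2)).re) (μ.prod ν) := hi3.re
  have h2 : ∫ p : Ω × α, (u p.1 * star (z p.2)).re ∂(μ.prod ν) = 0 := by
    refine (integral_re hi3).trans ?_
    rw [integral_prod_mul (fun ω => u ω) (fun x => star (z x))]
    have : ∫ x, star (z x) ∂ν = 0 := by
      simp only [RCLike.star_def]
      rw [integral_conj, hz0, map_zero]
    rw [this, mul_zero, map_zero]
  simp only [h1]
  rw [integral_add (by exact hi1.add hi2) (hi4.const_mul 2), integral_add hi1 hi2, integral_const_mul,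
    h2, integral_fun_fst (fun ω => ‖u ω‖ ^ 2), integral_fun_snd (fun x => ‖z x‖ ^ 2)]
  simp

variable {κ : Type*} [Fintype κ] {G : ℕ} {y : Ω → κ → ℂ} {lv : ℕ}

lemma integral_norm_sq_mulVec (hy : ∀ i, MemLp (fun ω => y ω i) 2 μ) (B : Matrix (Fin G) κ ℂ)
    (g : Fin G) :
    ∫ ω, ‖(B *ᵥ y ω) g‖ ^ 2 ∂μ = ((B * crossMoment μ y y * Bᴴ) g g).re := by
  rw [← crossMoment_mulVec hy hy, crossMoment, of_apply, integral_mul_star_self, Complex.ofReal_re]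

lemma adcInputPower_eq [IsProbabilityMeasure μ] (hy : ∀ i, MemLp (fun ω => y ω i) 2 μ) (B : Matrix (Fin G) κ ℂ)
    (γ : ℝ) (g : Fin G) :
    adcInputPower μ y lv B γ g
      = ((B * crossMoment μ y y * Bᴴ) g g).re + 2 * γ ^ 2 / (3 * (lv : ℝ) ^ 2) := by
  rw [adcInputPower, integral_norm_add_sq_prod (memLp_mulVec hy B g) (memLp_dither _)
    (integral_dither _), integral_norm_sq_mulVec hy, integral_dither_norm_sq, stepSize]
  rw [div_pow]
  ring

/-- Solving the support rule for `γ`: since the dither power is itself proportional to `γ ^ 2`, the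
support is determined by the largest undithered input power. -/
lemma isAdcSupport_iff [IsProbabilityMeasure μ] (hy : ∀ i, MemLp (fun ω => y ω i) 2 μ) (hG0 : 0 < G) {η : ℝ}
    (hη : 0 < η) (hην : 2 * η ^ 2 < 3 * (lv : ℝ) ^ 2) (B : Matrix (Fin G) κ ℂ) (γ : ℝ) :
    IsAdcSupport μ y lv η B γ ↔
      0 ≤ γ ∧ γ ^ 2 = kappa η lv * ⨆ g, ((B * crossMoment μ y y * Bᴴ) g g).re := by
  have : Nonempty (Fin G) := ⟨⟨0, hG0⟩⟩
  have hlv : 0 < 3 * (lv : ℝ) ^ 2 := lt_of_le_of_lt (by positivity) hην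
  have hpos : 0 < 1 - 2 * η ^ 2 / (3 * (lv : ℝ) ^ 2) := by
    rw [sub_pos, div_lt_one hlv]; exact hην
  rw [IsAdcSupport, and_congr_right_iff]
  intro _
  simp only [adcInputPower_eq hy]
  rw [← ciSup_add (Set.finite_range _).bddAbove, kappa]
  set m := ⨆ g, ((B * crossMoment μ y y * Bᴴ) g g).re
  have h1 : γ ^ 2 = η ^ 2 * (m + 2 * γ ^ 2 / (3 * (lv : ℝ) ^ 2)) ↔
      γ ^ 2 * (1 - 2 * η ^ 2 / (3 * (lv : ℝ) ^ 2)) = η ^ 2 * m := by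
    constructor <;> intro h <;> linear_combination h
  rw [h1, ← eq_div_iff hpos.ne']
  constructor <;> intro h <;> rw [h] <;> ring

lemma IsQuantNoise.crossMoment_self {κ : Type*} {y : Ω → κ → ℂ} {γ : ℝ} {e : Ω → Fin G → ℂ}
    (he : IsQuantNoise μ y lv γ e) :
    crossMoment μ e e
      = ((4 * γ ^ 2 / (3 * (lv : ℝ) ^ 2) : ℝ) : ℂ) • (1 : Matrix (Fin G) (Fin G) ℂ) := by
  ext g h
  rcases eq_or_ne g h with rfl | hgh
  · have hre : Integrable (fun ω => (e ω g).re ^ 2) μ := ((he.memLp g).re).integrable_sq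
    have him : Integrable (fun ω => (e ω g).im ^ 2) μ := ((he.memLp g).im).integrable_sq
    have h1 : ∀ ω, ‖e ω g‖ ^ 2 = (e ω g).re ^ 2 + (e ω g).im ^ 2 := fun ω => by
      rw [Complex.sq_norm, Complex.normSq_apply]; ring
    rw [crossMoment, of_apply, integral_mul_star_self]
    simp only [h1]
    rw [integral_add hre him, he.variance_re, he.variance_im, stepSize, Matrix.smul_apply,
      Matrix.one_apply_eq, smul_eq_mul, mul_one, div_pow]
    congr 1
    ring
  · rw [Matrix.smul_apply, Matrix.one_apply_ne hgh, smul_zero, crossMoment, of_apply,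
      he.white g h hgh]

/-- The distortion as a quadratic function of `D`: the vector `Γ y - D (B y + e)` is the image of the
stacked vector `(y, e)` under `[Γ - D B, -D]`. -/
lemma distortion_eq {ι : Type*} [Fintype ι] {Γ : Matrix ι κ ℂ} {ct : Ω → ι → ℂ} {γ : ℝ} {e : Ω → Fin G → ℂ}
    (hy : ∀ i, MemLp (fun ω => y ω i) 2 μ) (hct : ct =ᵐ[μ] fun ω => Γ *ᵥ y ω)
    (he : IsQuantNoise μ y lv γ e) (B : Matrix (Fin G) κ ℂ) (D : Matrix ι (Fin G) ℂ) :
    distortion μ ct y B e D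
      = (trace ((Γ - D * B) * crossMoment μ y y * (Γ - D * B)ᴴ
          + ((4 * γ ^ 2 / (3 * (lv : ℝ) ^ 2) : ℝ) : ℂ) • (D * Dᴴ))).re := by
  have hz : ∀ i, MemLp (fun ω => Sum.elim (y ω) (e ω) i) 2 μ := by
    rintro (i | i)
    exacts [hy i, he.memLp i]
  have h1 : distortion μ ct y B e D
      = ∫ ω, ∑ i, ‖(fromCols (Γ - D * B) (-D) *ᵥ Sum.elim (y ω) (e ω)) i‖ ^ 2 ∂μ := by
    refine integral_congr_ae ?_
    filter_upwards [hct] with ω h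
    refine Finset.sum_congr rfl fun i _ => ?_
    congr 2
    rw [h]
    simp only [fromCols_mulVec, Sum.elim_comp_inl, Sum.elim_comp_inr, Pi.add_apply, mulVec_add,
      sub_mulVec, neg_mulVec, Pi.sub_apply, Pi.neg_apply, mulVec_mulVec]
    ring
  have hey : crossMoment μ e y = 0 := by
    rw [← conjTranspose_crossMoment, he.uncorrelated, conjTranspose_zero]
  rw [h1, integral_sum_norm_sq (memLp_mulVec hz _), crossMoment_mulVec hz hz, crossMoment_sumElim,
    he.uncorrelated, hey, he.crossMoment_self, fromCols_mul_fromBlocks,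
    conjTranspose_fromCols_eq_fromRows_conjTranspose, fromCols_mul_fromRows]
  simp

end

/-! ### The linear Gaussian model -/

section LinearGaussianModel

lemma received_eq_fromCols_mulVec {Ω ι κ : Type*} [Fintype ι] [Fintype κ] [DecidableEq κ]
    {c : Ω → ι → ℂ} {n y : Ω → κ → ℂ} {H : Matrix κ ι ℂ} (hy : y = fun ω => H *ᵥ c ω + n ω) :
    y = fun ω => fromCols H 1 *ᵥ Sum.elim (c ω) (n ω) := by
  subst hy
  ext ω i
  simp [fromCols_mulVec]

variable {Ω : Type*} [MeasurableSpace Ω] {μ : Measure Ω}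

/-- Pseudo-moments `E[u vᵀ]`, encoded as `crossMoment μ u (star v)`, transform with the transpose. -/
lemma crossMoment_mulVec_star {ι κ ι' κ' : Type*} [Fintype ι] [Fintype κ] {u : Ω → ι → ℂ}
    {v : Ω → κ → ℂ} (hu : ∀ i, MemLp (fun ω => u ω i) 2 μ) (hv : ∀ i, MemLp (fun ω => v ω i) 2 μ)
    (P : Matrix ι' ι ℂ) (Q : Matrix κ' κ ℂ) :
    crossMoment μ (fun ω => P *ᵥ u ω) (fun ω => star (Q *ᵥ v ω))
      = P * crossMoment μ u (fun ω => star (v ω)) * Qᵀ := by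
  have h1 := crossMoment_mulVec (v := fun ω => star (v ω)) hu (fun i => (hv i).star) P (Q.map star)
  have h2 : ∀ ω, Q.map star *ᵥ star (v ω) = star (Q *ᵥ v ω) := fun ω => by
    ext i
    simp [mulVec, dotProduct]
  have h3 : (Q.map star)ᴴ = Qᵀ := by
    ext i j
    simp
  simpa only [h2, h3] using h1

open scoped ComplexOrder in
lemma crossMoment_self_posSemidef {ι : Type*} [Fintype ι] {u : Ω → ι → ℂ}
    (hu : ∀ i, MemLp (fun ω => u ω i) 2 μ) : (crossMoment μ u u).PosSemidef := by
  refine PosSemidef.of_dotProduct_mulVec_nonneg (conjTranspose_crossMoment u u) fun x => ?_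
  set P : Matrix Unit ι ℂ := Matrix.of fun _ => star x
  have h1 := congrFun (congrFun (crossMoment_mulVec hu hu P P) ()) ()
  rw [crossMoment, of_apply, integral_mul_star_self] at h1
  have h2 : star x ⬝ᵥ (crossMoment μ u u *ᵥ x) = (P * crossMoment μ u u * Pᴴ) () () := by
    rw [Matrix.mul_assoc, Matrix.mul_apply_eq_vecMul]
    simp [P, Matrix.mul_apply, mulVec, dotProduct, vecMul, conjTranspose_apply]
  rw [h2, ← h1]
  exact_mod_cast integral_nonneg fun ω => by positivity

lemma IsCircularGaussian.memLp {ι : Type*} [Fintype ι] {x : Ω → ι → ℂ} {Q : Matrix ι ι ℂ}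
    (h : IsCircularGaussian μ x Q) (i : ι) : MemLp (fun ω => x ω i) 2 μ :=
  (h.gaussian.eval i).memLp_two

lemma crossMoment_eq_zero_of_indepFun {ι κ : Type*} {u : Ω → ι → ℂ} {v : Ω → κ → ℂ}
    (hu : ∀ i, MemLp (fun ω => u ω i) 2 μ) (hv : ∀ i, MemLp (fun ω => v ω i) 2 μ)
    (hu0 : ∀ i, ∫ ω, u ω i ∂μ = 0) (h : IndepFun u v μ) : crossMoment μ u v = 0 := by
  ext i j
  have h1 : IndepFun (fun ω => u ω i) (fun ω => star (v ω j)) μ :=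
    h.comp (φ := fun x : ι → ℂ => x i) (ψ := fun x : κ → ℂ => star (x j)) (measurable_pi_apply i)
      (continuous_star.measurable.comp (measurable_pi_apply j))
  rw [crossMoment, of_apply, h1.integral_fun_mul_eq_mul_integral (hu i).1 (hv j).star.1, hu0,
    zero_mul, Matrix.zero_apply]

variable {ι κ : Type*} [Fintype ι] [Fintype κ] {c : Ω → ι → ℂ} {n y : Ω → κ → ℂ}
  {Sc : Matrix ι ι ℂ} {Sn : Matrix κ κ ℂ} {H : Matrix κ ι ℂ}

lemma memLp_received (hc : IsCircularGaussian μ c Sc) (hn : IsCircularGaussian μ n Sn)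
    (hy : y = fun ω => H *ᵥ c ω + n ω) (i : κ) : MemLp (fun ω => y ω i) 2 μ := by
  subst hy
  exact (memLp_mulVec hc.memLp H i).add (hn.memLp i)

variable [DecidableEq κ]

lemma crossMoment_received (hc : IsCircularGaussian μ c Sc) (hn : IsCircularGaussian μ n Sn)
    (hcn : IndepFun c n μ) (hy : y = fun ω => H *ᵥ c ω + n ω) :
    crossMoment μ y y = H * Sc * Hᴴ + Sn := by
  classical
  have hz : ∀ i, MemLp (fun ω => Sum.elim (c ω) (n ω) i) 2 μ := by
    rintro (i | i)
    exacts [hc.memLp i, hn.memLp i]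
  rw [received_eq_fromCols_mulVec hy, crossMoment_mulVec hz hz, crossMoment_sumElim, hc.covariance,
    hn.covariance, crossMoment_eq_zero_of_indepFun hc.memLp hn.memLp hc.mean_zero hcn,
    crossMoment_eq_zero_of_indepFun hn.memLp hc.memLp hn.mean_zero hcn.symm,
    fromCols_mul_fromBlocks, conjTranspose_fromCols_eq_fromRows_conjTranspose,
    fromCols_mul_fromRows]
  simp

open scoped ComplexOrder in
lemma crossMoment_received_posDef {σ : ℝ} (hσ : 0 < σ) (hc : IsCircularGaussian μ c Sc)
    (hn : IsCircularGaussian μ n (((σ ^ 2 : ℝ) : ℂ) • (1 : Matrix κ κ ℂ)))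
    (hcn : IndepFun c n μ) (hy : y = fun ω => H *ᵥ c ω + n ω) : (crossMoment μ y y).PosDef := by
  rw [crossMoment_received hc hn hcn hy, ← hc.covariance]
  refine PosDef.posSemidef_add ((crossMoment_self_posSemidef hc.memLp).mul_mul_conjTranspose_same H)
    (PosDef.one.smul ?_)
  exact_mod_cast pow_pos hσ 2

/-- In the linear model `c` and `y` are images of the stacked vector `(c, n)`, which is circular; so
the MMSE estimate of `c` is linear. -/
lemma mmse_received_ae_eq (hcm : Measurable c) (hnm : Measurable n)
    (hc : IsCircularGaussian μ c Sc) (hn : IsCircularGaussian μ n Sn) (hcn : IndepFun c n μ)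
    (hy : y = fun ω => H *ᵥ c ω + n ω) (hdet : IsUnit (crossMoment μ y y).det) :
    mmse μ c y =ᵐ[μ] fun ω => linearEstimator μ c y *ᵥ y ω := by
  classical
  have hz : ∀ i, MemLp (fun ω => Sum.elim (c ω) (n ω) i) 2 μ := by
    rintro (i | i)
    exacts [hc.memLp i, hn.memLp i]
  have hyz := received_eq_fromCols_mulVec hy
  have hcz : c = fun ω => fromCols 1 (0 : Matrix ι κ ℂ) *ᵥ Sum.elim (c ω) (n ω) := by
    ext ω i
    simp [fromCols_mulVec]
  have hpz : crossMoment μ (fun ω => Sum.elim (c ω) (n ω))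
      (fun ω => star (Sum.elim (c ω) (n ω))) = 0 := by
    have hcross := crossMoment_eq_zero_of_indepFun (v := fun ω => star (n ω)) hc.memLp
      (fun i => (hn.memLp i).star) hc.mean_zero
      (hcn.comp (φ := id) (ψ := star) measurable_id continuous_star.measurable)
    have hcross' := crossMoment_eq_zero_of_indepFun (v := fun ω => star (c ω)) hn.memLp
      (fun i => (hc.memLp i).star) hn.mean_zero
      (hcn.symm.comp (φ := id) (ψ := star) measurable_id continuous_star.measurable)
    ext (i | i) (j | j)
    · simpa [crossMoment] using hc.circular i j
    · exact congrFun (congrFun hcross i) j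
    · exact congrFun (congrFun hcross' i) j
    · simpa [crossMoment] using hn.circular i j
  have hpc : crossMoment μ c (fun ω => star (y ω)) = 0 := by
    have := crossMoment_mulVec_star hz hz (fromCols 1 (0 : Matrix ι κ ℂ)) (fromCols H 1)
    rw [hpz, Matrix.mul_zero, Matrix.zero_mul, ← hcz] at this
    rw [hyz]
    exact this
  have hpy : crossMoment μ y (fun ω => star (y ω)) = 0 := by
    rw [hyz, crossMoment_mulVec_star hz hz, hpz, Matrix.mul_zero, Matrix.zero_mul]
  have hym : Measurable y := by
    subst hy
    exact ((mulVec_measurable H).comp hcm).add hnm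
  have hG : HasGaussianLaw (fun ω => (c ω, y ω)) μ := by
    let F : (ι → ℂ) × (κ → ℂ) →ₗ[ℝ] (ι → ℂ) × (κ → ℂ) :=
      (LinearMap.fst ℝ _ _).prod
        ((H.mulVecLin.restrictScalars ℝ) ∘ₗ LinearMap.fst ℝ _ _ + LinearMap.snd ℝ _ _)
    have := (hcn.hasGaussianLaw hc.gaussian hn.gaussian).map F.toContinuousLinearMap
    subst hy
    exact this
  have hy0 : ∀ i, ∫ ω, y ω i ∂μ = 0 := by
    intro i
    have := hc.gaussian.isProbabilityMeasure
    have h1 : ∀ k, Integrable (fun ω => H i k * c ω k) μ := fun k =>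
      ((hc.memLp k).integrable one_le_two).const_mul _
    subst hy
    simp only [Pi.add_apply, mulVec, dotProduct]
    rw [integral_add (integrable_finsetSum _ fun k _ => h1 k)
      ((hn.memLp i).integrable one_le_two), integral_finsetSum _ fun k _ => h1 k]
    simp [integral_const_mul, hc.mean_zero, hn.mean_zero]
  exact mmse_ae_eq_linearEstimator hcm hym hG hc.mean_zero hy0 hpc hpy hdet

end LinearGaussianModel

/-! ### Optimal digital processing -/

section Digital

variable {ι κ : Type*} [Fintype ι] [Fintype κ] {G : ℕ}
  {Γ : Matrix ι κ ℂ} {Sy : Matrix κ κ ℂ} {B : Matrix (Fin G) κ ℂ}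

lemma digitalMSE_zero (lv : ℕ) (γ : ℝ) :
    digitalMSE Γ Sy lv (0 : Matrix (Fin G) κ ℂ) γ = (trace (Γ * Sy * Γᴴ)).re := by
  simp [digitalMSE]

/-- Completing the square in the digital matrix `D`. -/
lemma trace_complete_square (hSy : Sy.IsHermitian) {s : ℝ}
    (hdet : IsUnit (B * Sy * Bᴴ + (s : ℂ) • (1 : Matrix _ _ ℂ)).det) (D : Matrix ι (Fin G) ℂ) :
    let M := B * Sy * Bᴴ + (s : ℂ) • (1 : Matrix _ _ ℂ)
    let D₀ := Γ * Sy * Bᴴ * M⁻¹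
    trace ((Γ - D * B) * Sy * (Γ - D * B)ᴴ + (s : ℂ) • (D * Dᴴ))
      = trace (Γ * Sy * Γᴴ) - trace (Γ * Sy * Bᴴ * M⁻¹ * B * Sy * Γᴴ)
        + trace ((D - D₀) * M * (D - D₀)ᴴ) := by
  intro M D₀
  have hMH : Mᴴ = M := by
    simp [M, conjTranspose_mul, hSy.eq, Matrix.mul_assoc]
  have h1 : D₀ * M = Γ * Sy * Bᴴ := by
    simp only [D₀]
    rw [Matrix.mul_assoc, nonsing_inv_mul _ hdet, Matrix.mul_one]
  have h2 : M * D₀ᴴ = B * Sy * Γᴴ := by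
    rw [← hMH, ← conjTranspose_mul, h1]
    simp [conjTranspose_mul, hSy.eq, Matrix.mul_assoc]
  have h3 : D₀ * M * D₀ᴴ = Γ * Sy * Bᴴ * M⁻¹ * B * Sy * Γᴴ := by
    rw [Matrix.mul_assoc, h2]
    simp only [D₀, Matrix.mul_assoc]
  rw [← trace_sub, ← trace_add]
  congr 1
  rw [← h3]
  have h4 : (D - D₀) * M * (D - D₀)ᴴ
      = D * M * Dᴴ - D * (B * Sy * Γᴴ) - Γ * Sy * Bᴴ * Dᴴ + D₀ * M * D₀ᴴ := by
    rw [conjTranspose_sub, Matrix.sub_mul, Matrix.mul_sub, Matrix.sub_mul, Matrix.sub_mul, h1,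
      Matrix.mul_assoc D M D₀ᴴ, h2, ← h1]
    abel
  have h5 : D * M * Dᴴ = D * (B * Sy * Bᴴ) * Dᴴ + (s : ℂ) • (D * Dᴴ) := by
    simp [M, Matrix.mul_add, Matrix.add_mul]
  rw [h4, h5]
  simp only [conjTranspose_sub, conjTranspose_mul, Matrix.sub_mul, Matrix.mul_sub, Matrix.mul_assoc]
  abel

open scoped ComplexOrder in
lemma posDef_add_smul_one (hSy : Sy.PosSemidef) {s : ℝ} (hs : 0 < s) :
    (B * Sy * Bᴴ + (s : ℂ) • (1 : Matrix _ _ ℂ)).PosDef :=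
  PosDef.posSemidef_add (hSy.mul_mul_conjTranspose_same B)
    (PosDef.one.smul (by exact_mod_cast hs))

open scoped ComplexOrder in
/-- For `γ = 0` the matrix to be inverted vanishes, but then so does `B`, and every `D` gives the same
value. -/
lemma isLeast_digitalMSE (hSy : Sy.PosSemidef) {lv : ℕ} {γ : ℝ}
    (hB : B = 0 ∧ γ = 0 ∨ 0 < 4 * γ ^ 2 / (3 * (lv : ℝ) ^ 2)) :
    IsLeast (Set.range fun D : Matrix ι (Fin G) ℂ =>
      (trace ((Γ - D * B) * Sy * (Γ - D * B)ᴴ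
        + ((4 * γ ^ 2 / (3 * (lv : ℝ) ^ 2) : ℝ) : ℂ) • (D * Dᴴ))).re)
      (digitalMSE Γ Sy lv B γ) := by
  rcases hB with ⟨rfl, rfl⟩ | hs
  · rw [digitalMSE_zero]
    refine ⟨⟨0, by simp⟩, ?_⟩
    rintro _ ⟨D, rfl⟩
    simp
  · have hM := posDef_add_smul_one (B := B) hSy hs
    have hdet := hM.isUnit.map Matrix.detMonoidHom
    have key := trace_complete_square (Γ := Γ) hSy.1 hdet
    refine ⟨⟨Γ * Sy * Bᴴ * (B * Sy * Bᴴ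
      + ((4 * γ ^ 2 / (3 * (lv : ℝ) ^ 2) : ℝ) : ℂ) • (1 : Matrix _ _ ℂ))⁻¹, ?_⟩, ?_⟩
    · dsimp only
      rw [key, sub_self, Matrix.zero_mul, Matrix.zero_mul, trace_zero, add_zero, digitalMSE]
    · rintro _ ⟨D, rfl⟩
      dsimp only
      rw [key, Complex.add_re, digitalMSE]
      have h := (hM.posSemidef.mul_mul_conjTranspose_same (D - Γ * Sy * Bᴴ * (B * Sy * Bᴴ
        + ((4 * γ ^ 2 / (3 * (lv : ℝ) ^ 2) : ℝ) : ℂ) • (1 : Matrix _ _ ℂ))⁻¹)).trace_nonneg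
      have := (Complex.le_def.1 h).1
      rw [Complex.zero_re] at this
      linarith

/-- The MSE in the whitened coordinates `A = Γ R`, `M = B R` with `R` a Hermitian root of `Sy`. -/
lemma digitalMSE_eq_sub_mseReduction {R : Matrix κ κ ℂ} (hR : R.IsHermitian) (hRR : R * R = Sy)
    (lv : ℕ) (γ : ℝ) :
    digitalMSE Γ Sy lv B γ = (trace (Γ * Sy * Γᴴ)).re
      - mseReduction (Γ * R) (B * R) (4 * γ ^ 2 / (3 * (lv : ℝ) ^ 2)) := by
  rw [digitalMSE, Complex.sub_re, mseReduction, ← hRR]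
  simp only [conjTranspose_mul, hR.eq, Matrix.mul_assoc]

end Digital

/-! ### Optimality of the water-filling combiner -/

section Optimality

variable {κ : Type*} [Fintype κ] {G : ℕ} {Sy : Matrix κ κ ℂ}

open scoped ComplexOrder in
lemma eq_zero_of_iSup_diag_eq_zero (hSy : Sy.PosDef) {B : Matrix (Fin G) κ ℂ}
    (h : ⨆ g, ((B * Sy * Bᴴ) g g).re = 0) : B = 0 := by
  ext g k
  have h1 : (B * Sy * Bᴴ) g g = star (star (B g)) ⬝ᵥ (Sy *ᵥ star (B g)) := by
    rw [star_star, Matrix.mul_assoc, Matrix.mul_apply_eq_vecMul]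
    rfl
  have h2 : ((B * Sy * Bᴴ) g g).re ≤ 0 := h ▸ le_ciSup (f := fun g => ((B * Sy * Bᴴ) g g).re)
    (Set.finite_range _).bddAbove g
  by_contra hk
  have h3 : star (B g) ≠ 0 := by
    intro h0
    exact hk (by simpa using congrFun (star_eq_zero.1 h0) k)
  have h4 := (Complex.lt_def.1 (hSy.dotProduct_mulVec_pos h3)).1
  rw [← h1, Complex.zero_re] at h4
  linarith

lemma trace_re_le_mul_iSup_diag (P : Matrix (Fin G) (Fin G) ℂ) :
    (trace P).re ≤ G * ⨆ g, (P g g).re := by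
  rw [trace, Complex.re_sum]
  refine (Finset.sum_le_card_nsmul _ _ (⨆ g, (P g g).re) fun g _ =>
    le_ciSup (f := fun g => (P g g).re) (Set.finite_range _).bddAbove g).trans_eq ?_
  simp

open scoped ComplexOrder in
/-- A combiner with support `0` is the zero combiner; otherwise the quantization noise has
positive variance. -/
lemma eq_zero_or_noise_pos (hSy : Sy.PosDef) {K : ℝ} (hK : 0 < K) {lv : ℕ}
    (hlv : 0 < lv) {B : Matrix (Fin G) κ ℂ} {γ : ℝ}
    (h : γ ^ 2 = K * ⨆ g, ((B * Sy * Bᴴ) g g).re) :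
    B = 0 ∧ γ = 0 ∨ 0 < 4 * γ ^ 2 / (3 * (lv : ℝ) ^ 2) := by
  rcases eq_or_ne γ 0 with rfl | hγ
  · refine Or.inl ⟨eq_zero_of_iSup_diag_eq_zero hSy ?_, rfl⟩
    have : K * ⨆ g, ((B * Sy * Bᴴ) g g).re = 0 := by rw [← h]; norm_num
    exact (mul_eq_zero.1 this).resolve_left hK.ne'
  · exact Or.inr (by positivity)

end Optimality

end TaskQuant

theorem proposition1 {Ω : Type*} [MeasurableSpace Ω] (μ : Measure Ω) [IsProbabilityMeasure μ]
    (N K L T τ G : ℕ) (hG0 : 0 < G) (hG : G ≤ N * T * τ)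
    (ν η σ : ℝ) (hν : 1 ≤ ν) (hσ : 0 < σ) (hη : 0 < η)
    (hην : 2 * η ^ 2 < 3 * (TaskQuant.adcLevels ν G : ℝ) ^ 2)
    (S : Matrix (Fin L) (Fin T) ℂ) (X : Matrix (Fin K) (Fin τ) ℂ)
    (Sc : Matrix (TaskQuant.ChanIdx N K L) (TaskQuant.ChanIdx N K L) ℂ)
    (c : Ω → TaskQuant.ChanIdx N K L → ℂ) (n y : Ω → TaskQuant.ObsIdx N T τ → ℂ)
    (hcm : Measurable c) (hnm : Measurable n)
    (hc : TaskQuant.IsCircularGaussian μ c Sc)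
    (hn : TaskQuant.IsCircularGaussian μ n (((σ ^ 2 : ℝ) : ℂ) •
      (1 : Matrix (TaskQuant.ObsIdx N T τ) (TaskQuant.ObsIdx N T τ) ℂ)))
    (hcn : IndepFun c n μ)
    (hy : y = TaskQuant.received S X c n)
    (lv : ℕ) (hlv : lv = TaskQuant.adcLevels ν G)
    (Sy : Matrix (TaskQuant.ObsIdx N T τ) (TaskQuant.ObsIdx N T τ) ℂ)
    (hSy : Sy = TaskQuant.crossMoment μ y y)
    (Γ : Matrix (TaskQuant.ChanIdx N K L) (TaskQuant.ObsIdx N T τ) ℂ)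
    (hΓ : Γ = TaskQuant.linearEstimator μ c y) (hΓ0 : Γ ≠ 0)
    (κ a : ℝ) (hκ : κ = TaskQuant.kappa η lv) (ha : a = 4 * κ / (3 * (lv : ℝ) ^ 2 * G)) :
    -- `digitalMSE` is the least value of `E ‖c̃ - ĉ‖²` over the digital matrices
    (∀ (B : Matrix (Fin G) (TaskQuant.ObsIdx N T τ) ℂ) (γ : ℝ) (e : Ω → Fin G → ℂ),
      TaskQuant.IsAdcSupport μ y lv η B γ → TaskQuant.IsQuantNoise μ y lv γ e →
      IsLeast (Set.range (TaskQuant.distortion μ (TaskQuant.mmse μ c y) y B e))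
        (TaskQuant.digitalMSE Γ Sy lv B γ)) ∧
    -- the factors of the optimal combiner exist
    (∃ (V : Matrix (TaskQuant.ObsIdx N T τ) (Fin (N * T * τ)) ℂ) (ζ : ℝ)
        (Λ : Matrix (Fin G) (Fin (N * T * τ)) ℂ) (U : Matrix (Fin G) (Fin G) ℂ),
        TaskQuant.IsWaterFillingDesign hG (Γ * CFC.sqrt Sy) a V ζ Λ U) ∧
    ∀ (V : Matrix (TaskQuant.ObsIdx N T τ) (Fin (N * T * τ)) ℂ) (ζ : ℝ)
      (Λ : Matrix (Fin G) (Fin (N * T * τ)) ℂ) (U : Matrix (Fin G) (Fin G) ℂ)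
      (B₀ : Matrix (Fin G) (TaskQuant.ObsIdx N T τ) ℂ),
      TaskQuant.IsWaterFillingDesign hG (Γ * CFC.sqrt Sy) a V ζ Λ U →
      B₀ = TaskQuant.combiner Sy V Λ U →
      -- the resulting support
      (∀ γ : ℝ, TaskQuant.IsAdcSupport μ y lv η B₀ γ ↔ γ = √(κ / G)) ∧
      -- `B₀` minimises the MSE over all combiners, each with its support
      (∀ (B : Matrix (Fin G) (TaskQuant.ObsIdx N T τ) ℂ) (γ : ℝ),
        TaskQuant.IsAdcSupport μ y lv η B γ →
        TaskQuant.digitalMSE Γ Sy lv B₀ √(κ / G) ≤ TaskQuant.digitalMSE Γ Sy lv B γ) := by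
  open scoped ComplexOrder in
  -- `lv = 0` would turn the hypothesis on `η` into `2 η² < 0`.
  have hlv0 : 0 < lv := by
    rw [hlv, Nat.pos_iff_ne_zero]
    intro h0
    rw [h0] at hην
    norm_num at hην
    nlinarith [sq_nonneg η]
  rw [← hlv] at hην
  have hlvR : (0 : ℝ) < 3 * (lv : ℝ) ^ 2 := by positivity
  have hκ0 : 0 < κ := by
    have : 0 < 1 - 2 * η ^ 2 / (3 * (lv : ℝ) ^ 2) := by
      rw [sub_pos, div_lt_one hlvR]; exact hην
    rw [hκ, TaskQuant.kappa]
    positivity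
  have hGR : (0 : ℝ) < G := by exact_mod_cast hG0
  have ha0 : 0 < a := by rw [ha]; positivity
  have hyi := TaskQuant.memLp_received hc hn hy
  have hPD := TaskQuant.crossMoment_received_posDef hσ hc hn hcn hy
  rw [← hSy] at hPD
  have hdet : IsUnit Sy.det := hPD.isUnit.map Matrix.detMonoidHom
  have hsupp : ∀ (B : Matrix (Fin G) (TaskQuant.ObsIdx N T τ) ℂ) (γ : ℝ),
      TaskQuant.IsAdcSupport μ y lv η B γ ↔
        0 ≤ γ ∧ γ ^ 2 = κ * ⨆ g, ((B * Sy * Bᴴ) g g).re := by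
    intro B γ
    rw [hκ, hSy]
    exact TaskQuant.isAdcSupport_iff hyi hG0 hη hην B γ
  set R := CFC.sqrt Sy with hRdef
  have hRR : R * R = Sy := CFC.sqrt_mul_sqrt_self Sy hPD.posSemidef.nonneg
  have hR : R.IsHermitian := (CFC.sqrt_nonneg Sy).posSemidef.1
  have hRdet : IsUnit R.det := by
    rw [← hRR, det_mul] at hdet
    exact isUnit_of_mul_isUnit_left hdet
  have hA0 : Γ * R ≠ 0 := by
    intro h0
    apply hΓ0
    rw [← Matrix.mul_one Γ, ← mul_nonsing_inv R hRdet, ← Matrix.mul_assoc, h0, Matrix.zero_mul]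
  refine ⟨fun B γ e hB he => ?_, ?_, fun V ζ Λ U B₀ hD hB₀ => ?_⟩
  · have hct := TaskQuant.mmse_received_ae_eq hcm hnm hc hn hcn hy (hSy ▸ hdet)
    rw [← hΓ] at hct
    have h1 : TaskQuant.distortion μ (TaskQuant.mmse μ c y) y B e = fun D =>
        (trace ((Γ - D * B) * Sy * (Γ - D * B)ᴴ
          + ((4 * γ ^ 2 / (3 * (lv : ℝ) ^ 2) : ℝ) : ℂ) • (D * Dᴴ))).re := by
      ext D
      rw [TaskQuant.distortion_eq hyi hct he, ← hSy]
    rw [h1]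
    exact TaskQuant.isLeast_digitalMSE hPD.posSemidef
      (TaskQuant.eq_zero_or_noise_pos hPD hκ0 hlv0 ((hsupp B γ).1 hB).2)
  · exact TaskQuant.exists_isWaterFillingDesign hA0
      (by simp [TaskQuant.ObsIdx]; ring) hG0 hG ha0
  · have hB₀R : B₀ * R = U * Λ * Vᴴ := by
      rw [hB₀, TaskQuant.combiner, Matrix.mul_assoc, nonsing_inv_mul _ hRdet, Matrix.mul_one]
    have hcov : B₀ * Sy * B₀ᴴ = U * Λ * Λᴴ * Uᴴ := by
      have : B₀ * Sy * B₀ᴴ = (B₀ * R) * (B₀ * R)ᴴ := by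
        rw [← hRR, conjTranspose_mul, hR.eq]
        simp only [Matrix.mul_assoc]
      rw [this, hB₀R]
      simp only [conjTranspose_mul, conjTranspose_conjTranspose, Matrix.mul_assoc]
      rw [← Matrix.mul_assoc Vᴴ, hD.right_singular.unitary_left, Matrix.one_mul]
    have hsup : ⨆ g, ((B₀ * Sy * B₀ᴴ) g g).re = 1 / G := by
      have : Nonempty (Fin G) := ⟨⟨0, hG0⟩⟩
      have h1 : ∀ g, ((B₀ * Sy * B₀ᴴ) g g).re = 1 / G := fun g => by
        rw [hcov, hD.diag_apply_eq hG0 ha0, Complex.ofReal_re]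
      simp only [h1, ciSup_const]
    have hnoise : 4 * √(κ / G) ^ 2 / (3 * (lv : ℝ) ^ 2) = a := by
      rw [Real.sq_sqrt (by positivity), ha]
      field_simp
    refine ⟨fun γ => ?_, fun B γ hB => ?_⟩
    · rw [hsupp, hsup, mul_one_div]
      constructor
      · rintro ⟨h1, h2⟩
        rw [← h2, Real.sqrt_sq h1]
      · rintro rfl
        exact ⟨Real.sqrt_nonneg _, Real.sq_sqrt (by positivity)⟩
    · obtain ⟨-, hγ⟩ := (hsupp B γ).1 hB
      have hopt := hD.mseReduction_eq ha0
      have hζ := hD.water_level_pos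
      rw [TaskQuant.digitalMSE_eq_sub_mseReduction hR hRR, hnoise, hB₀R, hopt]
      rcases TaskQuant.eq_zero_or_noise_pos hPD hκ0 hlv0 hγ with ⟨rfl, -⟩ | hs
      · rw [TaskQuant.digitalMSE_zero]
        have : 0 ≤ ζ⁻¹ ^ 2 / a
            + ∑ g : Fin G, max (TaskQuant.singVal (Γ * R) g - ζ⁻¹) 0 ^ 2 := by positivity
        linarith
      · rw [TaskQuant.digitalMSE_eq_sub_mseReduction hR hRR]
        refine sub_le_sub_left (TaskQuant.mseReduction_le hG0 hG hD.right_singular _ ha0 hs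
          (inv_pos.2 hζ) ?_) _
        have h1 : (B * R) * (B * R)ᴴ = B * Sy * Bᴴ := by
          rw [← hRR, conjTranspose_mul, hR.eq]
          simp only [Matrix.mul_assoc]
        rw [h1, hγ]
        refine (mul_le_mul_of_nonneg_left
          (TaskQuant.trace_re_le_mul_iSup_diag (B * Sy * Bᴴ)) ha0.le).trans_eq ?_
        rw [ha]
        field_simp
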